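/- **Setting.** Let $\phi:\mathbb R\to[0,+\infty]$ be convex and lower semicontinuous, with $\phi(1)=0$, $\phi=+\infty$ on $(-\infty,0)$, and $\phi<\infty$ in a neighbourhood of $1$. Put $\phi'(\infty)=\lim_{x\to\infty}\phi(x)/x$ and $\psi(x)=\phi(x+1)$; $f^\star(t)=\sup_x\{xt-f(x)\}$ denotes the convex conjugate. For probability measures $\mu,\nu$ on a measurable space $(\Omega,\mathcal F)$, with Lebesgue decomposition $\mu=\mu_c+\mu_s$ relative to $\nu$, let $D(\mu\|\nu)=\int\phi\big(\tfrac{d\mu_c}{d\nu}\big)\,d\nu+\mu_s(\Omega)\,\phi'(\infty)$, with $0\cdot\infty=0$. Let $X$ be a vector space of finite signed measures on $\Omega$, let $\Xi$ be the $\sigma$-ideal of measurable sets that are $|\mu|$-null for all $\mu\in X$, and let $Y\subseteq L^0(\Xi)$ be a vector space of (classes of) real measurable functions such that $\mu(h)=\int h\,d\mu$ is absolutely convergent for all $\mu\in X$, $h\in Y$ and puts $X$ and $Y$ in separating duality. Let $X^1$ be the set of probability measures in $X$, let $N\subseteq X^1$, and let $G\subseteq Y$ be non-empty. Assume that $(X,Y)$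 is $\nu$-decomposable for every $\nu\in N$: $X$ contains every measure $\mu\ll\nu$ with $\frac{d\mu}{d\nu}\in L^\infty(\nu)$; $L^\infty(\Xi)\subseteq Y$; and for every measurable $A\notin\Xi$ there is a non-negative $\mu\in X\setminus\{0\}$ with $\mu(\Omega\setminus A)=0$. Write $d_G(\mu,\nu)=\sup_{g\in G}|\mu(g)-\nu(g)|\in[0,\infty]$. For $\varepsilon\ge0$ let $$\mathcal L_{G,N}(\varepsilon)=\inf\Big\{D(\mu\|\nu): \nu\in N,\ \mu\in X^1,\ \sup_{g\in G}(\mu(g)-\nu(g))=\varepsilon\Big\},$$ and for $\varepsilon<0$ define $\mathcal L_{G,N}(\varepsilon)$ in the same way with the constraint $\inf_{g\in G}(\mu(g)-\nu(g))=\varepsilon$; write $\mathcal L_{g,N}=\mathcal L_{\{g\},N}$. For $t\in\mathbb R$ let $$K_{g,\nu,\Xi}(t)=\inf\Big\{\int\psi^\star(tg+\lambda)\,d\nu:\ \lambda\in\mathbb R,\ \lambda+\operatorname{ess\,sup}_\Xi(tg)\le\phi'(\infty)\Big\},\qquad K_{G,N,\Xi}=\sup_{g\in G,\,\nu\in N}K_{g,\nu,\Xi}.$$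 **Theorem.** One has $\big(\inf_{g\in G}\mathcal L_{g,N}\big)^\star=K_{G,N,\Xi}$ on $\mathbb R$. If moreover $d_G(\mu,\nu)<\infty$ for all $\nu\in N$, $\mu\in X^1$ with $D(\mu\|\nu)<\infty$, then also $\mathcal L_{G,N}^\star=\big(\inf_{g\in G}\mathcal L_{g,N}\big)^\star=K_{G,N,\Xi}$. **Corollary.** Let $L:[0,\infty)\to[-\infty,+\infty]$ be convex and lower semicontinuous, put $L(\infty)=\lim_{x\to\infty}L(x)$ and $L^\star(s)=\sup_{x\ge0}\{xs-L(x)\}$. Consider 1. $D(\mu\|\nu)\ge L(d_G(\mu,\nu))$ for all $\nu\in N$, $\mu\in X^1$; 2. $D(\mu\|\nu)\ge L(|\mu(g)-\nu(g)|)$ for all $g\in G$, $\nu\in N$, $\mu\in X^1$; 3. $K_{g,\nu,\Xi}(t)\le L^\star(|t|)$ for all $t\in\mathbb R$, $g\in G$, $\nu\in N$. Then (1) and (2) are equivalent and imply (3). If $L$ does not take the value $-\infty$ or is identically $-\infty$, and if $L$ is non-decreasing or $L(0)\le0$, then (1), (2) and (3) are equivalent. -/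

import Mathlib

open MeasureTheory Filter Topology
open scoped ENNReal NNReal

noncomputable section

namespace PhiIPM

variable {Ω : Type*} [MeasurableSpace Ω]

/-! ### Convex analysis on the real line -/

/-- Convexity of an extended-real-valued function, as convexity of the epigraph
(this is the convention `(+∞) + (-∞) = +∞`). -/
def EConvex (f : ℝ → EReal) : Prop :=
  Convex ℝ {p : ℝ × ℝ | f p.1 ≤ (p.2 : EReal)}

/-- The convex conjugate `f*(t) = sup_x (x t - f x)`. -/
def conj (f : ℝ → EReal) (t : ℝ) : EReal :=
  ⨆ x : ℝ, ((x * t : ℝ) : EReal) - f x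

/-- The extension by `+∞` to the real line of a function on `[0, ∞)`. -/
def extendTop (L : ℝ≥0 → EReal) (x : ℝ) : EReal :=
  if 0 ≤ x then L x.toNNReal else ⊤

/-- The value of `L` at a point of `[0, ∞]`; at `∞` it is the limit of `L` at infinity, which
exists in the extended reals when `L` is convex (and then equals this `limsup`). -/
def evalExt (L : ℝ≥0 → EReal) (d : ℝ≥0∞) : EReal :=
  if d = ⊤ then limsup L atTop else L d.toNNReal

/-- `φ'(∞) = lim_{x → ∞} φ(x) / x`. The limit exists in the extended reals for every proper convex
`φ` (and then equals this `limsup`). -/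
def slopeTop (φ : ℝ → EReal) : EReal :=
  limsup (fun x : ℝ => φ x / (x : EReal)) atTop

/-- The standing assumptions on the function `φ` defining the divergence: convex, lower
semicontinuous, `φ 1 = 0`, `+∞` on the negative reals, with global minimum `0`
(that is `0 ∈ ∂φ(1)`), and finite in a neighbourhood of `1`. -/
structure IsDivergenceGenerator (φ : ℝ → EReal) : Prop where
  convex : EConvex φ
  lsc : LowerSemicontinuous φ
  map_one : φ 1 = 0
  eq_top_of_neg : ∀ x < 0, φ x = ⊤
  nonneg : ∀ x, 0 ≤ φ x
  finite_near_one : ∀ᶠ x in 𝓝 (1 : ℝ), φ x < ⊤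

/-! ### Divergence and integral probability metric -/

/-- Integral of an extended-real-valued function: integral of the positive part minus integral of
the negative part. -/
def eintegral (ν : Measure Ω) (f : Ω → EReal) : EReal :=
  ((∫⁻ ω, (f ω).toENNReal ∂ν : ℝ≥0∞) : EReal) - ((∫⁻ ω, (-f ω).toENNReal ∂ν : ℝ≥0∞) : EReal)

/-- The `φ`-divergence of non-negative measures, `ν(φ(dμ_c/dν)) + μ_s(Ω) φ'(∞)`, where
`μ = μ_c + μ_s` is the Lebesgue decomposition with respect to `ν` (and `0 * ∞ = 0`). -/
def phiDiv (φ : ℝ → EReal) (μ ν : Measure Ω) : EReal :=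
  eintegral ν (fun ω => φ (μ.rnDeriv ν ω).toReal)
    + ((μ.singularPart ν Set.univ : ℝ≥0∞) : EReal) * slopeTop φ

/-- The mean deviation `μ(g) - ν(g)`. -/
def meanDev (g : Ω → ℝ) (μ ν : Measure Ω) : ℝ :=
  ∫ ω, g ω ∂μ - ∫ ω, g ω ∂ν

open Classical in
/-- The integral probability metric `sup_{g ∈ G} |μ(g) - ν(g)|`, equal to `∞` when some `g ∈ G` is
not integrable with respect to both measures. -/
def ipm (G : Set (Ω → ℝ)) (μ ν : Measure Ω) : ℝ≥0∞ :=
  ⨆ g ∈ G, if Integrable g μ ∧ Integrable g ν then ENNReal.ofReal |meanDev g μ ν| else ⊤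

/-- The optimal lower bound on the divergence `D(μ‖ν)`, `μ ∈ M`, `ν ∈ N`, under the constraint
`sup_{g ∈ G} (μ(g) - ν(g)) = ε` if `0 ≤ ε`, and `inf_{g ∈ G} (μ(g) - ν(g)) = ε` if `ε < 0`. -/
def lowerBound (φ : ℝ → EReal) (M : Set (ProbabilityMeasure Ω)) (G : Set (Ω → ℝ))
    (N : Set (ProbabilityMeasure Ω)) (ε : ℝ) : EReal :=
  if 0 ≤ ε then
    sInf {d : EReal | ∃ ν ∈ N, ∃ μ ∈ M,
      (⨆ g ∈ G, ((meanDev g (μ : Measure Ω) (ν : Measure Ω) : ℝ) : EReal)) = (ε : EReal) ∧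
      d = phiDiv φ (μ : Measure Ω) (ν : Measure Ω)}
  else
    sInf {d : EReal | ∃ ν ∈ N, ∃ μ ∈ M,
      (⨅ g ∈ G, ((meanDev g (μ : Measure Ω) (ν : Measure Ω) : ℝ) : EReal)) = (ε : EReal) ∧
      d = phiDiv φ (μ : Measure Ω) (ν : Measure Ω)}

/-! ### Null ideals, essential ranges, cumulant generating functions -/

/-- The `σ`-ideal of measurable sets which are null for all signed measures in `X`. -/
def nullIdeal (X : Submodule ℝ (SignedMeasure Ω)) : Set (Set Ω) :=
  {A | MeasurableSet A ∧ ∀ μ ∈ X, μ.totalVariation A = 0}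

/-- The essential range of `f` with respect to a `σ`-ideal. -/
def essRange (Ξ : Set (Set Ω)) (f : Ω → ℝ) : Set ℝ :=
  {x | ∀ δ > 0, f ⁻¹' Set.Ioo (x - δ) (x + δ) ∉ Ξ}

/-- The essential supremum of `f` with respect to a `σ`-ideal. -/
def essSupIdeal (Ξ : Set (Set Ω)) (f : Ω → ℝ) : EReal :=
  sSup ((fun x : ℝ => (x : EReal)) '' essRange Ξ f)

/-- The `(φ, ν, Ξ)`-cumulant generating function
`K_{g,ν,Ξ}(t) = inf {ν(ψ*(t g + c)) : c ∈ ℝ, c + ess sup_Ξ (t g) ≤ φ'(∞)}`, with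
`ψ x = φ (x + 1)`. -/
def cgf (φ : ℝ → EReal) (Ξ : Set (Set Ω)) (g : Ω → ℝ) (ν : Measure Ω) (t : ℝ) : EReal :=
  sInf {k : EReal | ∃ c : ℝ,
    (c : EReal) + essSupIdeal Ξ (fun ω => t * g ω) ≤ slopeTop φ ∧
    k = eintegral ν (fun ω => conj (fun x => φ (x + 1)) (t * g ω + c))}

/-- `K_{G,N,Ξ}(t) = sup {K_{g,ν,Ξ}(t) : g ∈ G, ν ∈ N}`. -/
def cgfSet (φ : ℝ → EReal) (Ξ : Set (Set Ω)) (G : Set (Ω → ℝ)) (N : Set (ProbabilityMeasure Ω))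
    (t : ℝ) : EReal :=
  ⨆ g ∈ G, ⨆ ν ∈ N, cgf φ Ξ g (ν : Measure Ω) t

/-! ### Dual pairs and decomposability -/

/-- The integral `μ(h)` of a function with respect to a finite signed measure. -/
def pairing (μ : SignedMeasure Ω) (h : Ω → ℝ) : ℝ :=
  ∫ ω, h ω ∂μ.toJordanDecomposition.posPart - ∫ ω, h ω ∂μ.toJordanDecomposition.negPart

/-- `(X, Y)` is a dual pair: `X` is a space of finite signed measures, `Y ⊆ L⁰(Ξ)` with `Ξ` the
null ideal of `X`, and `(μ, h) ↦ μ(h)` is a well-defined separating pairing. The space `Y` of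
classes is given by the representatives of its elements, so `h` is zero in `Y` when
`{h ≠ 0} ∈ Ξ`. -/
structure IsDualPair (X : Submodule ℝ (SignedMeasure Ω)) (Y : Submodule ℝ (Ω → ℝ)) : Prop where
  measurable : ∀ h ∈ Y, Measurable h
  integrable : ∀ μ ∈ X, ∀ h ∈ Y, Integrable h μ.totalVariation
  separating_left : ∀ μ ∈ X, μ ≠ 0 → ∃ h ∈ Y, pairing μ h ≠ 0
  separating_right : ∀ h ∈ Y, {ω | h ω ≠ 0} ∉ nullIdeal X → ∃ μ ∈ X, pairing μ h ≠ 0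

/-- `(X, Y)` is `ν`-decomposable, for a finite non-negative measure `ν` in `X`. -/
structure IsDecomposable (X : Submodule ℝ (SignedMeasure Ω)) (Y : Submodule ℝ (Ω → ℝ))
    (ν : Measure Ω) [IsFiniteMeasure ν] : Prop where
  mem : ν.toSignedMeasure ∈ X
  dualPair : IsDualPair X Y
  /-- `X` contains all measures with a bounded density with respect to `ν` -/
  bounded_density : ∀ f : Ω → ℝ, Measurable f → (∃ C : ℝ, ∀ᵐ ω ∂ν, |f ω| ≤ C) →
    ν.withDensityᵥ f ∈ X
  /-- `L^∞(Ξ) ⊆ Y` -/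
  essBounded_mem : ∀ f : Ω → ℝ, Measurable f → Bornology.IsBounded (essRange (nullIdeal X) f) →
    f ∈ Y
  exists_concentrated : ∀ A : Set Ω, MeasurableSet A → A ∉ nullIdeal X →
    ∃ (μ : Measure Ω) (_ : IsFiniteMeasure μ), μ.toSignedMeasure ∈ X ∧ μ ≠ 0 ∧ μ Aᶜ = 0

/-- The set `X¹` of probability measures in `X`. -/
def probIn (X : Submodule ℝ (SignedMeasure Ω)) : Set (ProbabilityMeasure Ω) :=
  {μ | (μ : Measure Ω).toSignedMeasure ∈ X}

/-! ### The three operational properties -/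

/-- `D(μ‖ν) ≥ L(d_G(μ, ν))` for all `ν ∈ N` and `μ ∈ M`. -/
def LowerBoundsByIPM (φ : ℝ → EReal) (M : Set (ProbabilityMeasure Ω)) (G : Set (Ω → ℝ))
    (N : Set (ProbabilityMeasure Ω)) (L : ℝ≥0 → EReal) : Prop :=
  ∀ ν ∈ N, ∀ μ ∈ M, evalExt L (ipm G (μ : Measure Ω) (ν : Measure Ω)) ≤
    phiDiv φ (μ : Measure Ω) (ν : Measure Ω)

/-- `D(μ‖ν) ≥ L(|μ(g) - ν(g)|)` for all `g ∈ G`, `ν ∈ N` and `μ ∈ M`. -/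
def LowerBoundsByDeviation (φ : ℝ → EReal) (M : Set (ProbabilityMeasure Ω)) (G : Set (Ω → ℝ))
    (N : Set (ProbabilityMeasure Ω)) (L : ℝ≥0 → EReal) : Prop :=
  ∀ g ∈ G, ∀ ν ∈ N, ∀ μ ∈ M, L (Real.toNNReal |meanDev g (μ : Measure Ω) (ν : Measure Ω)|) ≤
    phiDiv φ (μ : Measure Ω) (ν : Measure Ω)

/-- `K_{g,ν,Ξ}(t) ≤ L*(|t|)` for all `t ∈ ℝ`, `g ∈ G` and `ν ∈ N`. -/
def CgfBoundedByConj (φ : ℝ → EReal) (Ξ : Set (Set Ω)) (G : Set (Ω → ℝ))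
    (N : Set (ProbabilityMeasure Ω)) (L : ℝ≥0 → EReal) : Prop :=
  ∀ t : ℝ, ∀ g ∈ G, ∀ ν ∈ N, cgf φ Ξ g (ν : Measure Ω) t ≤ conj (extendTop L) |t|

end PhiIPM

end

open PhiIPM

open PhiIPM

/-! ### The conjugate of ψ and the recession slope of φ. -/

namespace PhiIPM

/-! The conjugate of an infimum is a supremum of conjugates, so the formula for `K` reduces to one
`g` and one `ν`: the claim is `K_{g,ν}(t) = sup_μ (t (μ(g) - ν(g)) - D(μ‖ν))`
(`IsDecomposable.cgf_le_iff`).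

The bound `≥` is weak duality (`IsDivergenceGenerator.ofReal_meanDev_le`): Fenchel-Young on the
absolutely continuous part of `μ`, and the constraint on `λ` on the singular part. For `≤`, with `f
= t g`, only the constraint `μ(Ω) = 1` is dualised. The pairs (mass, value minus cost) of the
measures `h ν + σ` form a convex subset of the plane, bounded above over mass 1, and finiteness of
`φ` near 1 supplies points on both sides; hence a line of some slope lies above the set, and this
slope gives `λ`. Large multiples of measures concentrated where `f` is nearly maximal force `λ` to
be admissible; bounded densities realising finite maxima of affine minorants of `ψ*` yield, by
monotone convergence, the bound on `∫ ψ*(f + λ) dν`.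

For `L_{G,N}`, the supremum (infimum) over `G` matters only when its product with `t` is positive,
and there it passes through the linear bound.

In the corollary, sublevel sets of `L` are closed intervals; (2) gives (1) by closedness, and (1)
gives (2) because they contain 0. An infinite `d_G` is handled by mixing `μ` with `ν`. That (3)
gives (2) is biconjugation: `L` is the supremum of its affine minorants. -/

theorem conj_shift_nonneg {φ : ℝ → EReal} (h1 : φ 1 = 0) (s : ℝ) :
    0 ≤ conj (fun x => φ (x + 1)) s := by
  refine le_iSup_of_le (0 : ℝ) ?_
  simp [h1]

/-- The conjugate of a non-negative function is a countable supremum of affine functions given by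
points of the epigraph. -/
theorem IsDivergenceGenerator.exists_affine_seq {φ : ℝ → EReal} (hφ : IsDivergenceGenerator φ) :
    ∃ x r : ℕ → ℝ, x 0 = 0 ∧ r 0 = 0 ∧ (∀ n, φ (x n + 1) ≤ (r n : EReal)) ∧
      ∀ s, conj (fun x => φ (x + 1)) s = ⨆ n, ((x n * s - r n : ℝ) : EReal) := by
  let E : Set (ℝ × ℝ) := {p | φ (p.1 + 1) ≤ (p.2 : EReal)}
  have hE : Nonempty E := ⟨⟨(0, 0), by simp [E, hφ.map_one]⟩⟩
  obtain ⟨u, hu⟩ := TopologicalSpace.exists_dense_seq E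
  -- The zero affine function is put at index 0, so that every finite maximum along the sequence is
  -- non-negative.
  let v : ℕ → ℝ × ℝ := fun n => Nat.casesOn n (0, 0) (fun k => (u k : ℝ × ℝ))
  have hv : ∀ n, φ ((v n).1 + 1) ≤ ((v n).2 : EReal) := by
    rintro (_ | k)
    · simp [v, hφ.map_one]
    · exact (u k).2
  refine ⟨fun n => (v n).1, fun n => (v n).2, rfl, rfl, hv, fun s => le_antisymm ?_ ?_⟩
  · refine iSup_le fun x => ?_
    by_cases htop : φ (x + 1) = ⊤
    · simp [htop]
    have hbot : φ (x + 1) ≠ ⊥ := fun h => by simpa [h] using hφ.nonneg (x + 1)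
    have key : ∀ p : E, ((p.1.1 * s - p.1.2 : ℝ) : EReal) ≤
        ⨆ n, (((v n).1 * s - (v n).2 : ℝ) : EReal) := by
      intro p
      refine hu.induction_on (p := fun p : E => ((p.1.1 * s - p.1.2 : ℝ) : EReal) ≤
        ⨆ n, (((v n).1 * s - (v n).2 : ℝ) : EReal)) p ?_ ?_
      · exact isClosed_le (continuous_coe_real_ereal.comp (by fun_prop)) continuous_const
      · intro n
        exact le_iSup (fun n => (((v n).1 * s - (v n).2 : ℝ) : EReal)) (n + 1)
    have := key ⟨(x, (φ (x + 1)).toReal), by simp [E, EReal.coe_toReal htop hbot]⟩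
    simpa [EReal.coe_sub, EReal.coe_toReal htop hbot] using this
  · refine iSup_le fun n => le_iSup_of_le ((v n).1) ?_
    rw [EReal.coe_sub]
    exact EReal.sub_le_sub le_rfl (hv n)

theorem IsDivergenceGenerator.mul_le_add_conj {φ : ℝ → EReal} (hφ : IsDivergenceGenerator φ)
    (x s : ℝ) : ((x * s : ℝ) : EReal) ≤ φ (x + 1) + conj (fun x => φ (x + 1)) s := by
  by_cases htop : φ (x + 1) = ⊤
  · have : conj (fun x => φ (x + 1)) s ≠ ⊥ := fun h => by
      simpa [h] using conj_shift_nonneg hφ.map_one s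
    simp [htop, EReal.top_add_of_ne_bot this]
  have hbot : φ (x + 1) ≠ ⊥ := fun h => by simpa [h] using hφ.nonneg (x + 1)
  have h : ((x * s : ℝ) : EReal) - φ (x + 1) ≤ conj (fun x => φ (x + 1)) s :=
    le_iSup (fun x : ℝ => ((x * s : ℝ) : EReal) - φ (x + 1)) x
  rw [add_comm]
  exact (EReal.sub_le_iff_le_add (Or.inl hbot) (Or.inl htop)).1 h

theorem IsDivergenceGenerator.slopeTop_nonneg {φ : ℝ → EReal} (hφ : IsDivergenceGenerator φ) :
    0 ≤ slopeTop φ := by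
  refine le_limsup_of_frequently_le (Eventually.frequently ?_)
  filter_upwards [eventually_gt_atTop 0] with x hx
  exact EReal.div_nonneg (hφ.nonneg x) (by exact_mod_cast hx.le)

/-- For large `z` one has `φ z ≤ β z`; the chord from `(x, r)` to `(z, β z)` bounds `φ` at `x + y`,
and its height there tends to `r + y β` as `z → ∞`. -/
theorem IsDivergenceGenerator.apply_add_le {φ : ℝ → EReal} (hφ : IsDivergenceGenerator φ)
    {x r y β : ℝ} (hx : φ x ≤ (r : EReal)) (hy : 0 ≤ y) (hβ : slopeTop φ < (β : EReal)) :
    φ (x + y) ≤ ((r + y * β : ℝ) : EReal) := by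
  have hev : ∀ᶠ z : ℝ in atTop, φ z / (z : EReal) < β := eventually_lt_of_limsup_lt hβ
  have hlim : Tendsto (fun z : ℝ => ((r + y * β + y / (z - x) * (β * x - r) : ℝ) : EReal)) atTop
      (𝓝 ((r + y * β : ℝ) : EReal)) := by
    refine (continuous_coe_real_ereal.tendsto _).comp ?_
    have h1 : Tendsto (fun z : ℝ => y / (z - x)) atTop (𝓝 0) :=
      Tendsto.div_atTop tendsto_const_nhds
        (tendsto_atTop_add_const_right _ (-x) tendsto_id)
    simpa using tendsto_const_nhds.add (h1.mul_const (β * x - r))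
  refine ge_of_tendsto hlim ?_
  filter_upwards [hev, eventually_gt_atTop 0, eventually_gt_atTop (x + y)] with z hz hz0 hzx
  have hzβ : φ z ≤ ((β * z : ℝ) : EReal) := by
    have := (EReal.div_le_iff_le_mul (by exact_mod_cast hz0) (EReal.coe_ne_top z)).1 hz.le
    rwa [mul_comm β z, EReal.coe_mul]
  have hpos : 0 < z - x := by linarith
  have hc := hφ.convex (x := (x, r)) hx (y := (z, β * z)) hzβ
    (a := 1 - y / (z - x)) (b := y / (z - x))
    (by rw [sub_nonneg, div_le_one hpos]; linarith) (by positivity) (by ring)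
  simp only [Prod.smul_mk, Prod.mk_add_mk, smul_eq_mul, Set.mem_ofPred_eq] at hc
  have e1 : (1 - y / (z - x)) * x + y / (z - x) * z = x + y := by field_simp; ring
  have e2 : (1 - y / (z - x)) * r + y / (z - x) * (β * z) =
      r + y * β + y / (z - x) * (β * x - r) := by field_simp; ring
  rwa [e1, e2] at hc

/-- Let `β` decrease to the recession slope in the previous bound. The case `y = 0` is separate
because of `0 * ∞ = 0`. -/
theorem IsDivergenceGenerator.toENNReal_apply_add_le {φ : ℝ → EReal}
    (hφ : IsDivergenceGenerator φ) (x y : ℝ) (hy : 0 ≤ y) :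
    (φ (x + y)).toENNReal ≤ (φ x).toENNReal + ENNReal.ofReal y * (slopeTop φ).toENNReal := by
  rcases hy.eq_or_lt with rfl | hy
  · simp
  by_cases hs : slopeTop φ = ⊤
  · simp [hs, ENNReal.mul_top, hy]
  by_cases hx : φ x = ⊤
  · simp [hx]
  have hxb : φ x ≠ ⊥ := fun h => by simpa [h] using hφ.nonneg x
  have hsb : slopeTop φ ≠ ⊥ := fun h => by simpa [h] using hφ.slopeTop_nonneg
  have h0 : 0 ≤ (slopeTop φ).toReal := EReal.toReal_nonneg hφ.slopeTop_nonneg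
  have h0x : 0 ≤ (φ x).toReal := EReal.toReal_nonneg (hφ.nonneg x)
  have key : φ (x + y) ≤ (((φ x).toReal + y * (slopeTop φ).toReal : ℝ) : EReal) := by
    have hlim : Tendsto (fun β : ℝ => (((φ x).toReal + y * β : ℝ) : EReal))
        (𝓝[>] (slopeTop φ).toReal) (𝓝 (((φ x).toReal + y * (slopeTop φ).toReal : ℝ) : EReal)) :=
      ((continuous_coe_real_ereal.comp (f := fun β : ℝ => (φ x).toReal + y * β)
        (by fun_prop)).tendsto _).mono_left nhdsWithin_le_nhds
    refine ge_of_tendsto hlim ?_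
    filter_upwards [self_mem_nhdsWithin] with β hβ
    refine hφ.apply_add_le (EReal.coe_toReal hx hxb).ge hy.le ?_
    rw [← EReal.coe_toReal hs hsb]
    exact_mod_cast hβ
  refine (EReal.toENNReal_le_toENNReal key).trans ?_
  rw [EReal.real_coe_toENNReal, ENNReal.ofReal_add h0x (by positivity), ENNReal.ofReal_mul hy.le,
    EReal.toENNReal_of_ne_top hx, EReal.toENNReal_of_ne_top hs]

end PhiIPM

/-! ### The divergence as a non-negative quantity, and its bounds. -/

namespace PhiIPM

variable {Ω : Type*} [MeasurableSpace Ω]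

theorem eintegral_of_nonneg (ν : Measure Ω) {f : Ω → EReal} (hf : ∀ ω, 0 ≤ f ω) :
    eintegral ν f = ((∫⁻ ω, (f ω).toENNReal ∂ν : ℝ≥0∞) : EReal) := by
  have : ∀ ω, (-f ω).toENNReal = 0 := fun ω =>
    EReal.toENNReal_of_nonpos (by simpa using hf ω)
  simp [eintegral, this]

/-- The `φ`-divergence as an extended non-negative real, for `φ ≥ 0`. -/
noncomputable def divENN (φ : ℝ → EReal) (μ ν : Measure Ω) : ℝ≥0∞ :=
  ∫⁻ ω, (φ (μ.rnDeriv ν ω).toReal).toENNReal ∂ν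
    + μ.singularPart ν Set.univ * (slopeTop φ).toENNReal

variable {φ : ℝ → EReal}

theorem IsDivergenceGenerator.phiDiv_eq (hφ : IsDivergenceGenerator φ) (μ ν : Measure Ω) :
    phiDiv φ μ ν = (divENN φ μ ν : EReal) := by
  rw [phiDiv, eintegral_of_nonneg ν (fun ω => hφ.nonneg _), divENN, EReal.coe_ennreal_add,
    EReal.coe_ennreal_mul, EReal.coe_toENNReal hφ.slopeTop_nonneg]

theorem IsDivergenceGenerator.measurable_toENNReal (hφ : IsDivergenceGenerator φ) {h : Ω → ℝ}
    (hm : Measurable h) : Measurable fun ω => (φ (h ω)).toENNReal :=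
  measurable_ereal_toENNReal.comp (hφ.lsc.measurable.comp hm)

theorem IsDivergenceGenerator.divENN_self (hφ : IsDivergenceGenerator φ) (ν : Measure Ω)
    [SigmaFinite ν] : divENN φ ν ν = 0 := by
  have h : ∫⁻ ω, (φ (ν.rnDeriv ν ω).toReal).toENNReal ∂ν = ∫⁻ _, 0 ∂ν := by
    refine lintegral_congr_ae ?_
    filter_upwards [ν.rnDeriv_self] with ω hω
    simp [hω, hφ.map_one]
  simp [divENN, h, Measure.singularPart_self]

/-- A density plus an arbitrary finite measure, charged at the rate `φ'(∞)`, bounds the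
divergence. -/
theorem IsDivergenceGenerator.divENN_withDensity_add_le (hφ : IsDivergenceGenerator φ)
    (ν σ : Measure Ω) [IsFiniteMeasure ν] [IsFiniteMeasure σ] {h : Ω → ℝ} (hm : Measurable h)
    (h0 : ∀ ω, 0 ≤ h ω) [IsFiniteMeasure (ν.withDensity fun ω => ENNReal.ofReal (h ω))] :
    divENN φ (ν.withDensity (fun ω => ENNReal.ofReal (h ω)) + σ) ν ≤
      ∫⁻ ω, (φ (h ω)).toENNReal ∂ν + σ Set.univ * (slopeTop φ).toENNReal := by
  have hrn : (ν.withDensity (fun ω => ENNReal.ofReal (h ω)) + σ).rnDeriv ν =ᵐ[ν]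
      fun ω => ENNReal.ofReal (h ω) + σ.rnDeriv ν ω := by
    filter_upwards [Measure.rnDeriv_add (ν.withDensity fun ω => ENNReal.ofReal (h ω)) σ ν,
      Measure.rnDeriv_withDensity ν hm.ennreal_ofReal] with ω h1 h2
    rw [h1, Pi.add_apply, h2]
  -- `σ` need not be singular to `ν`: its absolutely continuous part costs at most the rate `φ'(∞)`
  -- by the recession bound, its singular part exactly that rate.
  have hσ : σ.singularPart ν Set.univ + ∫⁻ ω, σ.rnDeriv ν ω ∂ν = σ Set.univ := by
    conv_rhs => rw [← Measure.singularPart_add_rnDeriv σ ν]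
    simp
  have hle : ∫⁻ ω, (φ ((ν.withDensity (fun ω => ENNReal.ofReal (h ω)) + σ).rnDeriv ν ω).toReal
        ).toENNReal ∂ν ≤
      ∫⁻ ω, (φ (h ω)).toENNReal + σ.rnDeriv ν ω * (slopeTop φ).toENNReal ∂ν := by
    refine lintegral_mono_ae ?_
    filter_upwards [hrn, σ.rnDeriv_lt_top ν] with ω h1 h2
    rw [h1, ENNReal.toReal_add ENNReal.ofReal_ne_top h2.ne, ENNReal.toReal_ofReal (h0 ω)]
    refine (hφ.toENNReal_apply_add_le _ _ ENNReal.toReal_nonneg).trans ?_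
    rw [ENNReal.ofReal_toReal h2.ne]
  rw [lintegral_add_left (hφ.measurable_toENNReal hm),
    lintegral_mul_const _ (Measure.measurable_rnDeriv σ ν)] at hle
  rw [divENN, Measure.singularPart_add, Measure.singularPart_withDensity, zero_add, ← hσ, add_mul,
    add_comm (σ.singularPart ν Set.univ * _), ← add_assoc]
  gcongr

theorem IsDivergenceGenerator.toENNReal_apply_mix_le (hφ : IsDivergenceGenerator φ)
    {a : ℝ} (ha : 0 < a) (ha1 : a ≤ 1) (x : ℝ) :
    (φ ((1 - a) + a * x)).toENNReal ≤ ENNReal.ofReal a * (φ x).toENNReal := by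
  by_cases hx : φ x = ⊤
  · simp [hx, ENNReal.mul_top, ha]
  have hxb : φ x ≠ ⊥ := fun h => by simpa [h] using hφ.nonneg x
  have hc := hφ.convex (x := (1, 0)) (by simp [hφ.map_one]) (y := (x, (φ x).toReal))
    (EReal.coe_toReal hx hxb).ge (a := 1 - a) (b := a) (by linarith) ha.le (by ring)
  simp only [Prod.smul_mk, Prod.mk_add_mk, smul_eq_mul, Set.mem_ofPred_eq, mul_one, mul_zero,
    zero_add] at hc
  refine (EReal.toENNReal_le_toENNReal hc).trans ?_
  rw [EReal.real_coe_toENNReal, ENNReal.ofReal_mul ha.le, EReal.toENNReal_of_ne_top hx]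

/-- Convexity against `φ 1 = 0` bounds the integrand pointwise, and `b • ν` adds nothing to the
singular part. -/
theorem IsDivergenceGenerator.divENN_mix_le (hφ : IsDivergenceGenerator φ)
    (μ ν : Measure Ω) [IsFiniteMeasure μ] [IsFiniteMeasure ν] {a b : ℝ≥0} (ha : 0 < a)
    (hab : b + a = 1) : divENN φ (b • ν + a • μ) ν ≤ a * divENN φ μ ν := by
  have hrn : (b • ν + a • μ).rnDeriv ν =ᵐ[ν] fun ω => (b : ℝ≥0∞) + a * μ.rnDeriv ν ω := by
    filter_upwards [Measure.rnDeriv_add (b • ν) (a • μ) ν, Measure.rnDeriv_smul_left ν ν b,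
      Measure.rnDeriv_smul_left μ ν a, ν.rnDeriv_self] with ω h1 h2 h3 h4
    rw [h1, Pi.add_apply, h2, h3, Pi.smul_apply, Pi.smul_apply, h4]
    simp [ENNReal.smul_def]
  have hb : (b : ℝ) = 1 - a := by rw [eq_sub_iff_add_eq]; exact_mod_cast hab
  have hle : ∫⁻ ω, (φ ((b • ν + a • μ).rnDeriv ν ω).toReal).toENNReal ∂ν ≤
      ∫⁻ ω, a * (φ (μ.rnDeriv ν ω).toReal).toENNReal ∂ν := by
    refine lintegral_mono_ae ?_
    filter_upwards [hrn, μ.rnDeriv_lt_top ν] with ω h1 h2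
    rw [h1, ENNReal.toReal_add (by simp) (ENNReal.mul_ne_top (by simp) h2.ne), ENNReal.toReal_mul]
    simp only [ENNReal.coe_toReal, hb]
    have ha1 : (a : ℝ) ≤ 1 := by have := b.2; linarith [show (0 : ℝ) ≤ b from b.2]
    simpa using hφ.toENNReal_apply_mix_le (a := a) (by exact_mod_cast ha) ha1
      (μ.rnDeriv ν ω).toReal
  rw [lintegral_const_mul _ (hφ.measurable_toENNReal
    (Measure.measurable_rnDeriv μ ν).ennreal_toReal)] at hle
  rw [divENN, divENN, Measure.singularPart_add, Measure.singularPart_smul,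
    Measure.singularPart_smul, Measure.singularPart_self, mul_add, smul_zero, zero_add]
  refine add_le_add hle ?_
  rw [Measure.smul_apply, ENNReal.smul_def, smul_eq_mul, mul_assoc]

end PhiIPM

/-! ### Weak duality. -/

namespace PhiIPM

variable {Ω : Type*} [MeasurableSpace Ω] {φ : ℝ → EReal} {X : Submodule ℝ (SignedMeasure Ω)}
  {Y : Submodule ℝ (Ω → ℝ)}

theorem totalVariation_toSignedMeasure (μ : Measure Ω) [IsFiniteMeasure μ] :
    μ.toSignedMeasure.totalVariation = μ := by
  rw [SignedMeasure.totalVariation_eq_variation, Measure.variation_toSignedMeasure]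

theorem IsDualPair.integrable_of_mem (hXY : IsDualPair X Y) {μ : Measure Ω} [IsFiniteMeasure μ]
    (hμ : μ.toSignedMeasure ∈ X) {f : Ω → ℝ} (hf : f ∈ Y) : Integrable f μ := by
  simpa [totalVariation_toSignedMeasure] using hXY.integrable _ hμ f hf

theorem measure_eq_zero_of_mem_nullIdeal {μ : Measure Ω} [IsFiniteMeasure μ]
    (hμ : μ.toSignedMeasure ∈ X) {A : Set Ω} (hA : A ∈ nullIdeal X) : μ A = 0 := by
  simpa [totalVariation_toSignedMeasure] using hA.2 _ hμ

/-- The essential supremum with respect to the null ideal of `X` dominates a function almost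
everywhere for every measure in `X`. -/
theorem ae_le_of_essSupIdeal_le {μ : Measure Ω} [IsFiniteMeasure μ]
    (hμ : μ.toSignedMeasure ∈ X) {f : Ω → ℝ} {s : ℝ}
    (hs : essSupIdeal (nullIdeal X) f ≤ (s : EReal)) : ∀ᵐ ω ∂μ, f ω ≤ s := by
  have hx : ∀ x ∈ Set.Ioi s, ∃ δ > 0, f ⁻¹' Set.Ioo (x - δ) (x + δ) ∈ nullIdeal X := by
    intro x hx
    by_contra! hcon
    have hmem : x ∈ essRange (nullIdeal X) f := hcon
    have : (x : EReal) ≤ s := (le_sSup (Set.mem_image_of_mem _ hmem)).trans hs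
    exact absurd (by exact_mod_cast this) (not_le.2 (Set.mem_Ioi.1 hx))
  choose! δ hδ hmem using hx
  -- By the Lindelöf property, countably many of the intervals with null preimage cover `(s, ∞)`.
  obtain ⟨t, hts, htc, hcov⟩ := TopologicalSpace.countable_cover_nhdsWithin
    (f := fun x => Set.Ioo (x - δ x) (x + δ x)) (s := Set.Ioi s) fun x hx =>
      mem_nhdsWithin_of_mem_nhds (Ioo_mem_nhds (by linarith [hδ x hx]) (by linarith [hδ x hx]))
  have hnull : μ (⋃ x ∈ t, f ⁻¹' Set.Ioo (x - δ x) (x + δ x)) = 0 :=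
    (measure_biUnion_null_iff htc).2 fun x hx => measure_eq_zero_of_mem_nullIdeal hμ (hmem x (hts hx))
  refine measure_mono_null (fun ω hω => ?_) hnull
  have : f ω ∈ Set.Ioi s := not_le.1 (show ¬ f ω ≤ s from hω)
  simpa using hcov this

theorem ofReal_integral_le_lintegral {μ : Measure Ω} (u : Ω → ℝ) :
    ENNReal.ofReal (∫ ω, u ω ∂μ) ≤ ∫⁻ ω, ENNReal.ofReal (u ω) ∂μ := by
  by_cases hu : Integrable u μ
  · rw [integral_eq_lintegral_pos_part_sub_lintegral_neg_part hu]
    refine (ENNReal.ofReal_le_ofReal (sub_le_self _ ENNReal.toReal_nonneg)).trans ?_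
    exact ENNReal.ofReal_toReal_le
  -- The integral is 0 by default here, so the left side vanishes.
  · simp [integral_undef hu]

/-- Weak duality between the divergence and the integral of the conjugate. -/
theorem IsDivergenceGenerator.ofReal_meanDev_le (hφ : IsDivergenceGenerator φ)
    (hXY : IsDualPair X Y) {μ ν : Measure Ω} [IsProbabilityMeasure μ] [IsProbabilityMeasure ν]
    (hμ : μ.toSignedMeasure ∈ X) (hν : ν.toSignedMeasure ∈ X) {f : Ω → ℝ} (hf : f ∈ Y) {c : ℝ}
    (hc : (c : EReal) + essSupIdeal (nullIdeal X) f ≤ slopeTop φ) :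
    ENNReal.ofReal (meanDev f μ ν) ≤
      divENN φ μ ν + ∫⁻ ω, (conj (fun x => φ (x + 1)) (f ω + c)).toENNReal ∂ν := by
  have hfm : Measurable f := hXY.measurable f hf
  have hfμ := hXY.integrable_of_mem hμ hf
  have hfν := hXY.integrable_of_mem hν hf
  set p : Ω → ℝ := fun ω => (μ.rnDeriv ν ω).toReal with hp
  set F : Ω → ℝ := fun ω => f ω + c with hF
  have hFμ : Integrable F μ := hfμ.add (integrable_const c)
  have hFν : Integrable F ν := hfν.add (integrable_const c)
  have hFw : Integrable F (ν.withDensity (μ.rnDeriv ν)) :=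
    hFμ.mono_measure (Measure.withDensity_rnDeriv_le μ ν)
  have hFs : Integrable F (μ.singularPart ν) := hFμ.mono_measure (Measure.singularPart_le μ ν)
  have hpF : Integrable (fun ω => p ω * F ω) ν := by
    simpa [smul_eq_mul] using (integrable_withDensity_iff_integrable_smul'
      (Measure.measurable_rnDeriv μ ν) (μ.rnDeriv_lt_top ν)).1 hFw
  have hwint : ∫ ω, F ω ∂(ν.withDensity (μ.rnDeriv ν)) = ∫ ω, p ω * F ω ∂ν := by
    simpa [smul_eq_mul] using integral_withDensity_eq_integral_toReal_smul
      (Measure.measurable_rnDeriv μ ν) (μ.rnDeriv_lt_top ν) F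
  -- Both measures have mass 1, so the shift by `c` cancels.
  have hdev : meanDev f μ ν = ∫ ω, (p ω - 1) * F ω ∂ν + ∫ ω, F ω ∂(μ.singularPart ν) := by
    have h1 : ∫ ω, F ω ∂μ = ∫ ω, F ω ∂(μ.singularPart ν) + ∫ ω, p ω * F ω ∂ν := by
      conv_lhs => rw [← Measure.singularPart_add_rnDeriv μ ν]
      rw [integral_add_measure hFs hFw, hwint]
    have h2 : ∫ ω, (p ω - 1) * F ω ∂ν = ∫ ω, p ω * F ω ∂ν - ∫ ω, F ω ∂ν := by
      rw [← integral_sub hpF hFν]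
      exact integral_congr_ae (ae_of_all _ fun ω => by ring)
    have h3 : ∫ ω, F ω ∂μ = ∫ ω, f ω ∂μ + c := by
      rw [hF, integral_add hfμ (integrable_const c)]; simp
    have h4 : ∫ ω, F ω ∂ν = ∫ ω, f ω ∂ν + c := by
      rw [hF, integral_add hfν (integrable_const c)]; simp
    rw [meanDev]
    linarith
  have hsing : ENNReal.ofReal (∫ ω, F ω ∂(μ.singularPart ν)) ≤
      μ.singularPart ν Set.univ * (slopeTop φ).toENNReal := by
    refine (ofReal_integral_le_lintegral F).trans ?_
    rw [mul_comm, ← lintegral_const]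
    refine lintegral_mono_ae ?_
    by_cases hs : slopeTop φ = ⊤
    · simp [hs]
    have hsb : slopeTop φ ≠ ⊥ := fun h => by simpa [h] using hφ.slopeTop_nonneg
    have hle : essSupIdeal (nullIdeal X) f ≤ (((slopeTop φ).toReal - c : ℝ) : EReal) := by
      rw [EReal.coe_sub, EReal.coe_toReal hs hsb]
      exact (EReal.le_sub_iff_add_le (by simp) (by simp)).2 (by rwa [add_comm])
    have hae := ae_le_of_essSupIdeal_le hμ hle
    filter_upwards [ae_mono (Measure.singularPart_le μ ν) hae] with ω hω
    rw [EReal.toENNReal_of_ne_top hs]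
    exact ENNReal.ofReal_le_ofReal (by simp only [hF]; linarith)
  -- Fenchel-Young for `ψ` at `p - 1`, where `ψ (p - 1) = φ p`.
  have hcont : ENNReal.ofReal (∫ ω, (p ω - 1) * F ω ∂ν) ≤
      ∫⁻ ω, (φ (p ω)).toENNReal ∂ν
        + ∫⁻ ω, (conj (fun x => φ (x + 1)) (F ω)).toENNReal ∂ν := by
    refine (ofReal_integral_le_lintegral _).trans ?_
    rw [← lintegral_add_left (hφ.measurable_toENNReal
      (Measure.measurable_rnDeriv μ ν).ennreal_toReal)]
    refine lintegral_mono fun ω => ?_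
    have := EReal.toENNReal_le_toENNReal (hφ.mul_le_add_conj (p ω - 1) (F ω))
    rw [EReal.real_coe_toENNReal, sub_add_cancel, EReal.toENNReal_add (hφ.nonneg _)
      (conj_shift_nonneg hφ.map_one _)] at this
    exact this
  rw [hdev]
  refine ENNReal.ofReal_add_le.trans ((add_le_add hcont hsing).trans (le_of_eq ?_))
  rw [divENN, add_right_comm]

end PhiIPM

/-! ### The convex set of masses and values. -/

namespace PhiIPM

/-- A convex planar set whose fibre over `1` is bounded above and which has points on both sides
of `1` lies below a line through the top of that fibre. -/
theorem exists_slope_of_convex {C : Set (ℝ × ℝ)} (hC : Convex ℝ C) {S : ℝ}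
    (hS : ∀ v, ((1 : ℝ), v) ∈ C → v ≤ S) {p q : ℝ × ℝ} (hp : p ∈ C) (hq : q ∈ C) (hp1 : p.1 < 1)
    (hq1 : 1 < q.1) : ∃ c : ℝ, ∀ x ∈ C, x.2 + c * (x.1 - 1) ≤ S := by
  -- The segment from `x` to `y` crosses the vertical line over 1 at height at most `S`. Rearranged,
  -- this separates the slopes coming from the left from those coming from the right; any number in
  -- between, such as the supremum of the left ones, serves as `c`.
  have key : ∀ x ∈ C, x.1 < 1 → ∀ y ∈ C, 1 < y.1 →
      (x.2 - S) / (1 - x.1) ≤ (S - y.2) / (y.1 - 1) := by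
    intro x hx hx1 y hy hy1
    have hd : 0 < y.1 - x.1 := by linarith
    have hmem := hC hx hy (a := (y.1 - 1) / (y.1 - x.1)) (b := (1 - x.1) / (y.1 - x.1))
      (div_nonneg (by linarith) hd.le) (div_nonneg (by linarith) hd.le)
      (by rw [← add_div, div_eq_one_iff_eq hd.ne']; ring)
    have e1 : (y.1 - 1) / (y.1 - x.1) * x.1 + (1 - x.1) / (y.1 - x.1) * y.1 = 1 := by
      field_simp; ring
    have e : ((y.1 - 1) / (y.1 - x.1)) • x + ((1 - x.1) / (y.1 - x.1)) • y =
        (1, (y.1 - 1) / (y.1 - x.1) * x.2 + (1 - x.1) / (y.1 - x.1) * y.2) := by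
      ext
      · simpa using e1
      · simp
    rw [e] at hmem
    have h := hS _ hmem
    have e2 : (y.1 - 1) / (y.1 - x.1) * x.2 + (1 - x.1) / (y.1 - x.1) * y.2 =
        ((y.1 - 1) * x.2 + (1 - x.1) * y.2) / (y.1 - x.1) := by ring
    rw [e2, div_le_iff₀ hd] at h
    rw [div_le_div_iff₀ (by linarith) (by linarith)]
    nlinarith
  let A : Set ℝ := (fun x : ℝ × ℝ => (x.2 - S) / (1 - x.1)) '' {x | x ∈ C ∧ x.1 < 1}
  have hA : A.Nonempty := ⟨_, p, ⟨hp, hp1⟩, rfl⟩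
  have hAb : BddAbove A := by
    refine ⟨(S - q.2) / (q.1 - 1), ?_⟩
    rintro _ ⟨x, ⟨hx, hx1⟩, rfl⟩
    exact key x hx hx1 q hq hq1
  refine ⟨sSup A, fun x hx => ?_⟩
  rcases lt_trichotomy x.1 1 with h | h | h
  · have := le_csSup hAb ⟨x, ⟨hx, h⟩, rfl⟩
    simp only at this
    rw [div_le_iff₀ (by linarith)] at this
    linarith
  · have := hS x.2 (by rw [← h]; exact hx)
    simpa [h] using this
  · have : sSup A ≤ (S - x.2) / (x.1 - 1) := by
      refine csSup_le hA ?_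
      rintro _ ⟨y, ⟨hy, hy1⟩, rfl⟩
      exact key y hy hy1 x hx h
    rw [le_div_iff₀ (by linarith)] at this
    linarith

variable {Ω : Type*} [MeasurableSpace Ω] {φ : ℝ → EReal} {X : Submodule ℝ (SignedMeasure Ω)}
  {Y : Submodule ℝ (Ω → ℝ)}

/-- Bounded measurable densities `h` together with a bounded measurable majorant `r` of `φ ∘ h`. -/
structure IsTestDensity (φ : ℝ → EReal) (h r : Ω → ℝ) : Prop where
  measurable_density : Measurable h
  measurable_cost : Measurable r
  bounded : ∃ B : ℝ, ∀ ω, |h ω| ≤ B ∧ |r ω| ≤ B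
  le_cost : ∀ ω, φ (h ω) ≤ (r ω : EReal)

namespace IsTestDensity

theorem const {x s : ℝ} (hx : φ x ≤ (s : EReal)) :
    IsTestDensity φ (fun _ : Ω => x) (fun _ => s) :=
  ⟨measurable_const, measurable_const, ⟨max |x| |s|, fun _ => ⟨le_max_left _ _, le_max_right _ _⟩⟩,
    fun _ => hx⟩

variable {h r h' r' : Ω → ℝ}

/-- Gluing is what lets one density attain a pointwise maximum of finitely many affine functions. -/
theorem piecewise (H : IsTestDensity φ h r) (H' : IsTestDensity φ h' r') {A : Set Ω}
    (hA : MeasurableSet A) [DecidablePred (· ∈ A)] :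
    IsTestDensity φ (A.piecewise h h') (A.piecewise r r') := by
  obtain ⟨B, hB⟩ := H.bounded
  obtain ⟨B', hB'⟩ := H'.bounded
  refine ⟨H.1.piecewise hA H'.1, H.2.piecewise hA H'.2, ⟨max B B', fun ω => ?_⟩, fun ω => ?_⟩
  · by_cases hω : ω ∈ A
    · simp [hω, hB ω]
    · simp [hω, hB' ω]
  · by_cases hω : ω ∈ A
    · simpa [hω] using H.le_cost ω
    · simpa [hω] using H'.le_cost ω

theorem combo (hφ : EConvex φ) (H : IsTestDensity φ h r) (H' : IsTestDensity φ h' r') {a b : ℝ}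
    (ha : 0 ≤ a) (hb : 0 ≤ b) (hab : a + b = 1) :
    IsTestDensity φ (fun ω => a * h ω + b * h' ω) (fun ω => a * r ω + b * r' ω) := by
  obtain ⟨B, hB⟩ := H.bounded
  obtain ⟨B', hB'⟩ := H'.bounded
  have hbd : ∀ x y : ℝ, |x| ≤ B → |y| ≤ B' → |a * x + b * y| ≤ a * B + b * B' := by
    intro x y hx hy
    refine (abs_add_le _ _).trans ?_
    rw [abs_mul, abs_mul, abs_of_nonneg ha, abs_of_nonneg hb]
    gcongr
  refine ⟨(H.1.const_mul a).add (H'.1.const_mul b), (H.2.const_mul a).add (H'.2.const_mul b),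
    ⟨a * B + b * B', fun ω => ⟨hbd _ _ (hB ω).1 (hB' ω).1, hbd _ _ (hB ω).2 (hB' ω).2⟩⟩,
    fun ω => ?_⟩
  have := hφ (x := (h ω, r ω)) (H.le_cost ω) (y := (h' ω, r' ω)) (H'.le_cost ω) ha hb hab
  simpa using this

theorem integrable_density (H : IsTestDensity φ h r) (ν : Measure Ω) [IsFiniteMeasure ν] :
    Integrable h ν := by
  obtain ⟨B, hB⟩ := H.bounded
  exact Integrable.of_bound H.1.aestronglyMeasurable B (ae_of_all _ fun ω => (hB ω).1)

theorem integrable_cost (H : IsTestDensity φ h r) (ν : Measure Ω) [IsFiniteMeasure ν] :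
    Integrable r ν := by
  obtain ⟨B, hB⟩ := H.bounded
  exact Integrable.of_bound H.2.aestronglyMeasurable B (ae_of_all _ fun ω => (hB ω).2)

theorem integrable_mul (H : IsTestDensity φ h r) {ν : Measure Ω} {f : Ω → ℝ}
    (hf : Integrable f ν) : Integrable (fun ω => h ω * f ω) ν := by
  obtain ⟨B, hB⟩ := H.bounded
  exact hf.bdd_mul H.1.aestronglyMeasurable (ae_of_all _ fun ω => (hB ω).1)

theorem density_nonneg (hφ : IsDivergenceGenerator φ) (H : IsTestDensity φ h r) (ω : Ω) :
    0 ≤ h ω := by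
  by_contra! hlt
  have := H.le_cost ω
  rw [hφ.eq_top_of_neg _ hlt] at this
  simp at this

theorem cost_nonneg (hφ : IsDivergenceGenerator φ) (H : IsTestDensity φ h r) (ω : Ω) :
    0 ≤ r ω := by
  exact_mod_cast (hφ.nonneg _).trans (H.le_cost ω)

end IsTestDensity

/-- Pairs of total mass and linear functional minus cost, for the measures with a bounded density
with respect to `ν` plus an element of `X`. -/
def massValueSet (φ : ℝ → EReal) (X : Submodule ℝ (SignedMeasure Ω)) (ν : Measure Ω) (f : Ω → ℝ) :
    Set (ℝ × ℝ) :=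
  {p | ∃ (h r : Ω → ℝ) (σ : Measure Ω) (_ : IsFiniteMeasure σ), IsTestDensity φ h r ∧
    σ.toSignedMeasure ∈ X ∧ (slopeTop φ = ⊤ → σ = 0) ∧
    p = (∫ ω, h ω ∂ν + σ.real Set.univ,
      ∫ ω, h ω * f ω ∂ν - ∫ ω, r ω ∂ν + ∫ ω, f ω ∂σ - σ.real Set.univ * (slopeTop φ).toReal)}

/-- Both coordinates are linear in `(h, r, σ)`: charging a majorant `r` instead of `φ ∘ h` moves the
convexity of `φ` into the set of admissible triples. -/
theorem IsDualPair.convex_massValueSet (hXY : IsDualPair X Y) (hφ : EConvex φ) {ν : Measure Ω}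
    [IsFiniteMeasure ν] (hν : ν.toSignedMeasure ∈ X) {f : Ω → ℝ} (hf : f ∈ Y) :
    Convex ℝ (massValueSet φ X ν f) := by
  have hfν := hXY.integrable_of_mem hν hf
  rintro _ ⟨h, r, σ, hσ, H, hσX, hσt, rfl⟩ _ ⟨h', r', σ', hσ', H', hσX', hσt', rfl⟩ a b ha hb hab
  lift a to ℝ≥0 using ha
  lift b to ℝ≥0 using hb
  have hfσ := hXY.integrable_of_mem hσX hf
  have hfσ' := hXY.integrable_of_mem hσX' hf
  refine ⟨_, _, a • σ + b • σ', inferInstance, H.combo hφ H' a.coe_nonneg b.coe_nonneg hab, ?_, ?_, ?_⟩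
  · rw [Measure.toSignedMeasure_add, Measure.toSignedMeasure_smul, Measure.toSignedMeasure_smul]
    exact X.add_mem (X.smul_mem (a : ℝ) hσX) (X.smul_mem (b : ℝ) hσX')
  · intro ht
    rw [hσt ht, hσt' ht]
    simp
  · have e1 : ∫ ω, (a : ℝ) * h ω + b * h' ω ∂ν = a * ∫ ω, h ω ∂ν + b * ∫ ω, h' ω ∂ν := by
      rw [integral_add ((H.integrable_density ν).const_mul _)
        ((H'.integrable_density ν).const_mul _), integral_const_mul, integral_const_mul]
    have e2 : ∫ ω, (a : ℝ) * r ω + b * r' ω ∂ν = a * ∫ ω, r ω ∂ν + b * ∫ ω, r' ω ∂ν := by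
      rw [integral_add ((H.integrable_cost ν).const_mul _)
        ((H'.integrable_cost ν).const_mul _), integral_const_mul, integral_const_mul]
    have e3 : ∫ ω, ((a : ℝ) * h ω + b * h' ω) * f ω ∂ν =
        a * ∫ ω, h ω * f ω ∂ν + b * ∫ ω, h' ω * f ω ∂ν := by
      rw [← integral_const_mul, ← integral_const_mul, ← integral_add
        ((H.integrable_mul hfν).const_mul _) ((H'.integrable_mul hfν).const_mul _)]
      exact integral_congr_ae (ae_of_all _ fun ω => by ring)
    have e4 : ∫ ω, f ω ∂(a • σ + b • σ') = a * ∫ ω, f ω ∂σ + b * ∫ ω, f ω ∂σ' := by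
      rw [integral_add_measure hfσ.smul_measure_nnreal hfσ'.smul_measure_nnreal,
        integral_smul_nnreal_measure, integral_smul_nnreal_measure]
      simp [NNReal.smul_def]
    have e5 : (a • σ + b • σ').real Set.univ = a * σ.real Set.univ + b * σ'.real Set.univ := by
      rw [measureReal_add_apply, measureReal_nnreal_smul_apply, measureReal_nnreal_smul_apply]
    rw [e1, e2, e3, e4, e5]
    ext
    · simp; ring
    · simp; ring

end PhiIPM

/-! ### Strong duality. -/

namespace PhiIPM

variable {Ω : Type*} [MeasurableSpace Ω] {φ : ℝ → EReal} {X : Submodule ℝ (SignedMeasure Ω)}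
  {Y : Submodule ℝ (Ω → ℝ)}

/-- A point of mass one of `massValueSet` comes from a probability measure of `X`. -/
theorem IsDecomposable.exists_prob_of_mem_massValueSet {ν : Measure Ω} [IsFiniteMeasure ν]
    (hdec : IsDecomposable X Y ν) (hφ : IsDivergenceGenerator φ) {f : Ω → ℝ} (hf : f ∈ Y) {v : ℝ}
    (hv : ((1 : ℝ), v) ∈ massValueSet φ X ν f) :
    ∃ μ ∈ probIn X, divENN φ (μ : Measure Ω) ν ≠ ⊤ ∧
      v ≤ ∫ ω, f ω ∂(μ : Measure Ω) - (divENN φ (μ : Measure Ω) ν).toReal := by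
  obtain ⟨h, r, σ, hσ, H, hσX, hσt, hp⟩ := hv
  have hfν := hdec.dualPair.integrable_of_mem hdec.mem hf
  have hfσ := hdec.dualPair.integrable_of_mem hσX hf
  have hh0 := H.density_nonneg hφ
  have hr0 := H.cost_nonneg hφ
  have hlh : ∫⁻ ω, ENNReal.ofReal (h ω) ∂ν = ENNReal.ofReal (∫ ω, h ω ∂ν) :=
    (ofReal_integral_eq_lintegral_ofReal (H.integrable_density ν) (ae_of_all _ hh0)).symm
  have hlt : ∫⁻ ω, ENNReal.ofReal (h ω) ∂ν ≠ ⊤ := by rw [hlh]; exact ENNReal.ofReal_ne_top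
  have hfin : IsFiniteMeasure (ν.withDensity fun ω => ENNReal.ofReal (h ω)) :=
    isFiniteMeasure_withDensity hlt
  set κ := ν.withDensity fun ω => ENNReal.ofReal (h ω) with hκ
  have hκX : κ.toSignedMeasure ∈ X := by
    have := withDensityᵥ_toReal H.1.ennreal_ofReal.aemeasurable hlt
    rw [← this]
    simp only [ENNReal.toReal_ofReal (hh0 _)]
    obtain ⟨B, hB⟩ := H.bounded
    exact hdec.bounded_density h H.1 ⟨B, ae_of_all _ fun ω => (hB ω).1⟩
  have hmass : ∫ ω, h ω ∂ν + σ.real Set.univ = 1 := (congrArg Prod.fst hp).symm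
  have hprob : IsProbabilityMeasure (κ + σ) := by
    refine ⟨?_⟩
    rw [Measure.add_apply, hκ, withDensity_apply _ MeasurableSet.univ, Measure.restrict_univ, hlh,
      ← ofReal_measureReal (μ := σ), ← ENNReal.ofReal_add (integral_nonneg hh0) measureReal_nonneg,
      hmass, ENNReal.ofReal_one]
  -- For `φ'(∞) = ∞` the right side uses the default `toReal = 0`; the identity then holds because
  -- `σ = 0`.
  have hslope : σ Set.univ * (slopeTop φ).toENNReal =
      ENNReal.ofReal (σ.real Set.univ * (slopeTop φ).toReal) := by
    by_cases ht : slopeTop φ = ⊤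
    · simp [hσt ht]
    · rw [ENNReal.ofReal_mul measureReal_nonneg, ofReal_measureReal,
        EReal.toENNReal_of_ne_top ht]
  have hb : 0 ≤ (slopeTop φ).toReal := EReal.toReal_nonneg hφ.slopeTop_nonneg
  -- The nominal cost may exceed the divergence, as `σ` may overlap `ν` and `r` may exceed `φ ∘ h`;
  -- only this direction is needed.
  have hD : divENN φ (κ + σ) ν ≤
      ENNReal.ofReal (∫ ω, r ω ∂ν + σ.real Set.univ * (slopeTop φ).toReal) := by
    refine (hφ.divENN_withDensity_add_le ν σ H.1 hh0).trans ?_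
    rw [hslope, ENNReal.ofReal_add (integral_nonneg hr0) (mul_nonneg measureReal_nonneg hb),
      ofReal_integral_eq_lintegral_ofReal (H.integrable_cost ν) (ae_of_all _ hr0)]
    gcongr with ω
    exact EReal.toENNReal_le_toENNReal (H.le_cost ω)
  have hval : v = ∫ ω, h ω * f ω ∂ν - ∫ ω, r ω ∂ν + ∫ ω, f ω ∂σ
      - σ.real Set.univ * (slopeTop φ).toReal := congrArg Prod.snd hp
  have hfκ : Integrable f κ := hdec.dualPair.integrable_of_mem hκX hf
  have hint : ∫ ω, f ω ∂(κ + σ) = ∫ ω, h ω * f ω ∂ν + ∫ ω, f ω ∂σ := by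
    rw [integral_add_measure hfκ hfσ, hκ, integral_withDensity_eq_integral_toReal_smul
      H.1.ennreal_ofReal (ae_of_all _ fun ω => ENNReal.ofReal_lt_top)]
    simp only [ENNReal.toReal_ofReal (hh0 _), smul_eq_mul]
  refine ⟨⟨κ + σ, hprob⟩, ?_, ne_top_of_le_ne_top ENNReal.ofReal_ne_top hD, ?_⟩
  · change (κ + σ).toSignedMeasure ∈ X
    rw [Measure.toSignedMeasure_add]
    exact X.add_mem hκX hσX
  · have h1 := ENNReal.toReal_mono ENNReal.ofReal_ne_top hD
    rw [ENNReal.toReal_ofReal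
      (add_nonneg (integral_nonneg hr0) (mul_nonneg measureReal_nonneg hb))] at h1
    change v ≤ ∫ ω, f ω ∂(κ + σ) - (divENN φ (κ + σ) ν).toReal
    rw [hint, hval]
    linarith

/-- The constraint qualification: constant densities of finite cost with mass below and above 1. -/
theorem IsDivergenceGenerator.exists_two_sided (hφ : IsDivergenceGenerator φ) :
    ∃ x y s t : ℝ, x < 1 ∧ 1 < y ∧ φ x ≤ (s : EReal) ∧ φ y ≤ (t : EReal) := by
  obtain ⟨ε, hε, hball⟩ := Metric.eventually_nhds_iff.1 hφ.finite_near_one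
  have h1 : φ (1 - ε / 2) < ⊤ := hball (by rw [Real.dist_eq, abs_lt]; constructor <;> linarith)
  have h2 : φ (1 + ε / 2) < ⊤ := hball (by rw [Real.dist_eq, abs_lt]; constructor <;> linarith)
  exact ⟨1 - ε / 2, 1 + ε / 2, _, _, by linarith, by linarith, EReal.le_coe_toReal h1.ne,
    EReal.le_coe_toReal h2.ne⟩

/-- A multiplier for the mass constraint is admissible in the definition of the cumulant generating
function. -/
theorem IsDecomposable.add_essSupIdeal_le {ν : Measure Ω} [IsProbabilityMeasure ν]
    (hdec : IsDecomposable X Y ν) (hφ : IsDivergenceGenerator φ) {f : Ω → ℝ} (hf : f ∈ Y)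
    {c S : ℝ} (hc : ∀ x ∈ massValueSet φ X ν f, x.2 + c * (x.1 - 1) ≤ S) :
    (c : EReal) + essSupIdeal (nullIdeal X) f ≤ slopeTop φ := by
  by_cases ht : slopeTop φ = ⊤
  · simp [ht]
  have hsb : slopeTop φ ≠ ⊥ := fun h => by simpa [h] using hφ.slopeTop_nonneg
  set b := (slopeTop φ).toReal with hb
  have hbs : slopeTop φ = (b : EReal) := (EReal.coe_toReal ht hsb).symm
  have hfm := hdec.dualPair.measurable f hf
  suffices h : essSupIdeal (nullIdeal X) f ≤ ((b - c : ℝ) : EReal) by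
    rw [hbs, add_comm]
    rw [EReal.coe_sub] at h
    exact EReal.add_le_of_le_sub h
  refine sSup_le ?_
  rintro _ ⟨x, hx, rfl⟩
  rw [EReal.coe_le_coe_iff]
  by_contra! hlt
  -- Half the violation: where `f > x - δ`, one has `f + c - b > δ`. Hence adding `n τ` to `ν`
  -- raises the penalised value by at least `n δ τ(Ω)`, which eventually exceeds the bound `S`.
  set δ := (x + c - b) / 2 with hδ
  have hδ0 : 0 < δ := by rw [hδ]; linarith
  obtain ⟨τ, hτ, hτX, hτ0, hτA⟩ := hdec.exists_concentrated _ (hfm measurableSet_Ioo) (hx δ hδ0)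
  have hfτ := hdec.dualPair.integrable_of_mem hτX hf
  have hM : 0 < τ.real Set.univ := by
    rw [measureReal_def]
    exact ENNReal.toReal_pos (by simpa using hτ0) (measure_ne_top _ _)
  have hlow : (x - δ) * τ.real Set.univ ≤ ∫ ω, f ω ∂τ := by
    have h1 : ∫ _, (x - δ) ∂τ ≤ ∫ ω, f ω ∂τ := by
      refine integral_mono_ae (integrable_const _) hfτ ?_
      have : ∀ᵐ ω ∂τ, ω ∈ f ⁻¹' Set.Ioo (x - δ) (x + δ) := hτA
      filter_upwards [this] with ω hω using hω.1.le
    rw [integral_const, smul_eq_mul] at h1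
    linarith
  set T := S - ∫ ω, f ω ∂ν with hT
  obtain ⟨n, hn⟩ := exists_nat_gt (T / (δ * τ.real Set.univ))
  rw [div_lt_iff₀ (by positivity)] at hn
  have hmem : (1 + n * τ.real Set.univ, ∫ ω, f ω ∂ν + n * ∫ ω, f ω ∂τ - n * τ.real Set.univ * b) ∈
      massValueSet φ X ν f := by
    refine ⟨fun _ => 1, fun _ => 0, (n : ℝ≥0) • τ, inferInstance,
      IsTestDensity.const (by simp [hφ.map_one]), ?_, fun h => absurd h ht, ?_⟩
    · rw [Measure.toSignedMeasure_smul]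
      exact X.smul_mem ((n : ℝ≥0) : ℝ) hτX
    · rw [measureReal_nnreal_smul_apply, integral_smul_nnreal_measure]
      simp [NNReal.smul_def, hb]
  have := hc _ hmem
  simp only at this
  have hn0 : (0 : ℝ) ≤ n := n.cast_nonneg
  have e : (n : ℝ) * ((x - δ) * τ.real Set.univ) ≤ n * ∫ ω, f ω ∂τ :=
    mul_le_mul_of_nonneg_left hlow hn0
  have e2 : x = 2 * δ + b - c := by rw [hδ]; ring
  rw [e2] at e
  nlinarith

/-- Induction from the density 1 at cost 0: switch to the constant density `x (n + 1) + 1` on the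
set where the new affine function is at least the current value. -/
theorem IsDivergenceGenerator.exists_testDensity_max (hφ : IsDivergenceGenerator φ) {x r : ℕ → ℝ}
    (hx0 : x 0 = 0) (hr0 : r 0 = 0) (hxr : ∀ n, φ (x n + 1) ≤ (r n : EReal)) {F : Ω → ℝ}
    (hF : Measurable F) (n : ℕ) : ∃ h s : Ω → ℝ, IsTestDensity φ h s ∧
      ∀ ω, ∀ i ≤ n, x i * F ω - r i ≤ (h ω - 1) * F ω - s ω := by
  classical
  induction n with
  | zero =>
    refine ⟨_, _, IsTestDensity.const (x := 1) (s := 0) (by simp [hφ.map_one]), fun ω i hi => ?_⟩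
    simp [Nat.le_zero.1 hi, hx0, hr0]
  | succ n ih =>
    obtain ⟨h, s, H, hmax⟩ := ih
    let A : Set Ω := {ω | (h ω - 1) * F ω - s ω ≤ x (n + 1) * F ω - r (n + 1)}
    have hA : MeasurableSet A := measurableSet_le
      (((H.1.sub_const 1).mul hF).sub H.2) ((hF.const_mul _).sub_const _)
    refine ⟨_, _, (IsTestDensity.const (hxr (n + 1))).piecewise H hA, fun ω i hi => ?_⟩
    by_cases hω : ω ∈ A
    · have hω' : (h ω - 1) * F ω - s ω ≤ x (n + 1) * F ω - r (n + 1) := hω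
      rcases Nat.le_succ_iff.1 hi with hi | rfl
      · have := hmax ω i hi
        simp only [Set.piecewise_eq_of_mem _ _ _ hω, add_sub_cancel_right]
        linarith
      · simp [Set.piecewise_eq_of_mem _ _ _ hω]
    · have hω' : x (n + 1) * F ω - r (n + 1) < (h ω - 1) * F ω - s ω := not_le.1 hω
      rcases Nat.le_succ_iff.1 hi with hi | rfl
      · simpa [Set.piecewise_eq_of_notMem _ _ _ hω] using hmax ω i hi
      · simpa [Set.piecewise_eq_of_notMem _ _ _ hω] using hω'.le

/-- If every bounded density satisfies the penalised inequality, so does the pointwise supremum. -/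
theorem IsDivergenceGenerator.lintegral_conj_le (hφ : IsDivergenceGenerator φ) {ν : Measure Ω}
    [IsFiniteMeasure ν] {F : Ω → ℝ} (hF : Measurable F) (hFν : Integrable F ν) {S : ℝ}
    (hS : ∀ h s, IsTestDensity φ h s → ∫ ω, ((h ω - 1) * F ω - s ω) ∂ν ≤ S) :
    ∫⁻ ω, (conj (fun x => φ (x + 1)) (F ω)).toENNReal ∂ν ≤ ENNReal.ofReal S := by
  obtain ⟨x, r, hx0, hr0, hxr, hconj⟩ := hφ.exists_affine_seq
  set g : ℕ → Ω → ℝ≥0∞ := fun n ω => ⨆ i ≤ n, ENNReal.ofReal (x i * F ω - r i) with hg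
  have hle : ∀ ω, (conj (fun x => φ (x + 1)) (F ω)).toENNReal ≤ ⨆ n, g n ω := by
    intro ω
    have : conj (fun x => φ (x + 1)) (F ω) ≤ ((⨆ n, g n ω : ℝ≥0∞) : EReal) := by
      rw [hconj]
      refine iSup_le fun n => ?_
      have h1 : ((x n * F ω - r n : ℝ) : EReal) ≤
          ((ENNReal.ofReal (x n * F ω - r n) : ℝ≥0∞) : EReal) := by
        rw [EReal.coe_ennreal_ofReal]
        exact_mod_cast le_max_left _ _
      refine h1.trans (EReal.coe_ennreal_le_coe_ennreal_iff.2 ?_)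
      exact le_iSup_of_le n (le_iSup₂_of_le n le_rfl le_rfl)
    simpa using EReal.toENNReal_le_toENNReal this
  have hgm : ∀ n, Measurable (g n) := fun n =>
    Measurable.iSup fun i => Measurable.iSup fun _ =>
      ((hF.const_mul _).sub_const _).ennreal_ofReal
  have hmono : Monotone g := fun m n hmn ω =>
    iSup₂_le fun i hi => le_iSup₂_of_le i (hi.trans hmn) le_rfl
  refine (lintegral_mono hle).trans ?_
  rw [lintegral_iSup hgm hmono]
  refine iSup_le fun n => ?_
  obtain ⟨h, s, H, hmax⟩ := hφ.exists_testDensity_max hx0 hr0 hxr hF n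
  -- Index 0 is the zero function, so truncation by `ENNReal.ofReal` loses nothing.
  have hnn : ∀ ω, 0 ≤ (h ω - 1) * F ω - s ω := fun ω => by
    simpa [hx0, hr0] using hmax ω 0 n.zero_le
  have hint : Integrable (fun ω => (h ω - 1) * F ω - s ω) ν := by
    refine Integrable.sub ?_ (H.integrable_cost ν)
    have : Integrable (fun ω => h ω * F ω - F ω) ν := (H.integrable_mul hFν).sub hFν
    simpa only [sub_mul, one_mul] using this
  calc ∫⁻ ω, g n ω ∂ν ≤ ∫⁻ ω, ENNReal.ofReal ((h ω - 1) * F ω - s ω) ∂ν :=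
        lintegral_mono fun ω => iSup₂_le fun i hi => ENNReal.ofReal_le_ofReal (hmax ω i hi)
    _ = ENNReal.ofReal (∫ ω, ((h ω - 1) * F ω - s ω) ∂ν) :=
        (ofReal_integral_eq_lintegral_ofReal hint (ae_of_all _ hnn)).symm
    _ ≤ ENNReal.ofReal S := ENNReal.ofReal_le_ofReal (hS h s H)

/-- Strong duality: an upper bound for the mean deviation penalised by the divergence is attained
by an admissible constant. -/
theorem IsDecomposable.exists_lintegral_conj_le {ν : Measure Ω} [IsProbabilityMeasure ν]
    (hdec : IsDecomposable X Y ν) (hφ : IsDivergenceGenerator φ) {f : Ω → ℝ} (hf : f ∈ Y) {S : ℝ}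
    (hS : ∀ μ ∈ probIn X, divENN φ (μ : Measure Ω) ν ≠ ⊤ →
      meanDev f (μ : Measure Ω) ν ≤ S + (divENN φ (μ : Measure Ω) ν).toReal) :
    ∃ c : ℝ, (c : EReal) + essSupIdeal (nullIdeal X) f ≤ slopeTop φ ∧
      ∫⁻ ω, (conj (fun x => φ (x + 1)) (f ω + c)).toENNReal ∂ν ≤ ENNReal.ofReal S := by
  have hfν := hdec.dualPair.integrable_of_mem hdec.mem hf
  have hmem : ∀ {h s : Ω → ℝ}, IsTestDensity φ h s →
      (∫ ω, h ω ∂ν, ∫ ω, h ω * f ω ∂ν - ∫ ω, s ω ∂ν) ∈ massValueSet φ X ν f := fun {h s} H =>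
    ⟨h, s, 0, inferInstance, H, by simp, fun _ => rfl, by simp⟩
  obtain ⟨x, y, s, t, hx1, hy1, hx, hy⟩ := hφ.exists_two_sided
  -- Points over mass 1 come from probability measures in `X`, so the hypothesis bounds that fibre
  -- by `S + ν(f)`.
  obtain ⟨c, hc⟩ := exists_slope_of_convex
    (hdec.dualPair.convex_massValueSet hφ.convex hdec.mem hf) (S := S + ∫ ω, f ω ∂ν)
    (fun v hv => by
      obtain ⟨μ, hμ, hD, hle⟩ := hdec.exists_prob_of_mem_massValueSet hφ hf hv
      have := hS μ hμ hD
      rw [meanDev] at this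
      linarith)
    (hmem (IsTestDensity.const hx)) (hmem (IsTestDensity.const hy)) (by simpa using hx1)
    (by simpa using hy1)
  refine ⟨c, hdec.add_essSupIdeal_le hφ hf hc, ?_⟩
  refine hφ.lintegral_conj_le ((hdec.dualPair.measurable f hf).add_const c)
    (hfν.add (integrable_const c)) fun h s H => ?_
  have h1 := hc _ (hmem H)
  simp only at h1
  have e : ∫ ω, ((h ω - 1) * (f ω + c) - s ω) ∂ν =
      ∫ ω, h ω * f ω ∂ν - ∫ ω, f ω ∂ν + c * (∫ ω, h ω ∂ν - 1) - ∫ ω, s ω ∂ν := by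
    have : ∀ ω, (h ω - 1) * (f ω + c) - s ω = h ω * f ω - f ω + c * (h ω - 1) - s ω :=
      fun ω => by ring
    simp only [this]
    have i1 := H.integrable_mul hfν
    have i2 : Integrable (fun ω => h ω * f ω - f ω) ν := i1.sub hfν
    have i3 : Integrable (fun ω => c * (h ω - 1)) ν :=
      ((H.integrable_density ν).sub (integrable_const (1 : ℝ))).const_mul c
    have i4 : Integrable (fun ω => h ω * f ω - f ω + c * (h ω - 1)) ν := i2.add i3
    rw [integral_sub i4 (H.integrable_cost ν), integral_add i2 i3, integral_sub i1 hfν,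
      integral_const_mul]
    congr 3
    rw [integral_sub (H.integrable_density ν) (integrable_const _)]
    simp
  rw [e]
  linarith

end PhiIPM

/-! ### Convex lower semicontinuous functions on the half-line. -/

namespace PhiIPM

variable {L : ℝ≥0 → EReal}

theorem extendTop_coe (L : ℝ≥0 → EReal) (x : ℝ≥0) : extendTop L x = L x := by
  simp [extendTop]

theorem convex_sublevel (hL : EConvex (extendTop L)) (d : ℝ) :
    Convex ℝ {x : ℝ | extendTop L x ≤ (d : EReal)} := by
  intro x hx y hy a b ha hb hab
  have := hL (x := (x, d)) hx (y := (y, d)) hy ha hb hab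
  have e : a * d + b * d = d := by rw [← add_mul, hab, one_mul]
  simpa [e] using this

theorem le_of_mem_Icc (hL : EConvex (extendTop L)) {d : ℝ} {x y z : ℝ≥0}
    (hx : L x ≤ (d : EReal)) (hz : L z ≤ (d : EReal)) (hxy : x ≤ y) (hyz : y ≤ z) :
    L y ≤ (d : EReal) := by
  have := (convex_sublevel hL d).ordConnected.out (x := x) (y := z)
    (by simpa [extendTop_coe] using hx) (by simpa [extendTop_coe] using hz)
    (show (y : ℝ) ∈ Set.Icc (x : ℝ) z from ⟨by exact_mod_cast hxy, by exact_mod_cast hyz⟩)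
  simpa [extendTop_coe] using this

/-- The value at infinity is at most `d` when `L ≤ d` at arbitrarily large points. -/
theorem limsup_le_of_frequently (hL : EConvex (extendTop L)) {d : ℝ}
    (h : ∃ᶠ x in atTop, L x ≤ (d : EReal)) : limsup L atTop ≤ d := by
  obtain ⟨x, hx⟩ := h.exists
  refine limsup_le_of_le (h := ?_)
  filter_upwards [eventually_ge_atTop x] with y hy
  obtain ⟨z, hyz, hz⟩ := frequently_atTop.1 h y
  exact le_of_mem_Icc hL hx hz hy hyz

/-- For every `e > 0`, `L ≤ e` holds at 0 and at some point beyond `x`, hence at `x`. -/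
theorem apply_nonpos_of_limsup (hL : EConvex (extendTop L)) (h0 : L 0 ≤ 0)
    (h : limsup L atTop ≤ 0) (x : ℝ≥0) : L x ≤ 0 := by
  refine EReal.le_of_forall_lt_iff_le.1 fun e he => ?_
  have hev : ∀ᶠ y in atTop, L y < (e : EReal) := eventually_lt_of_limsup_lt (h.trans_lt he)
  obtain ⟨z, hz, hxz⟩ := (hev.and (eventually_ge_atTop x)).exists
  exact le_of_mem_Icc hL (h0.trans he.le) hz.le zero_le hxz

theorem isClosed_epigraph_extendTop (hL : LowerSemicontinuous L) :
    IsClosed {p : ℝ × ℝ | extendTop L p.1 ≤ (p.2 : EReal)} := by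
  have h1 : IsClosed {p : ℝ≥0 × EReal | L p.1 ≤ p.2} := hL.isClosed_epigraph
  have h2 : {p : ℝ × ℝ | extendTop L p.1 ≤ (p.2 : EReal)} = {p : ℝ × ℝ | 0 ≤ p.1} ∩
      (fun p : ℝ × ℝ => (p.1.toNNReal, (p.2 : EReal))) ⁻¹' {p : ℝ≥0 × EReal | L p.1 ≤ p.2} := by
    ext p
    by_cases hp : 0 ≤ p.1 <;> simp [extendTop, hp]
  rw [h2]
  refine (isClosed_le continuous_const continuous_fst).inter (h1.preimage ?_)
  exact (continuous_real_toNNReal.comp continuous_fst).prodMk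
    (continuous_coe_real_ereal.comp continuous_snd)

/-- Separation of a point below the graph from the epigraph. -/
theorem exists_separation (hL : EConvex (extendTop L)) (hlsc : LowerSemicontinuous L) {x r : ℝ}
    (h : (r : EReal) < extendTop L x) :
    ∃ u v k : ℝ, u * x + v * r < k ∧
      ∀ (y : ℝ≥0) (s : ℝ), L y ≤ (s : EReal) → k < u * y + v * s := by
  obtain ⟨f, k, hk, hf⟩ := geometric_hahn_banach_point_closed (x := (x, r)) hL
    (isClosed_epigraph_extendTop hlsc) (not_le.2 h)
  have hlin : ∀ a b : ℝ, f (a, b) = f (1, 0) * a + f (0, 1) * b := by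
    intro a b
    have : ((a, b) : ℝ × ℝ) = a • (1, 0) + b • (0, 1) := by simp
    rw [this, map_add, map_smul, map_smul]
    simp [mul_comm]
  refine ⟨f (1, 0), f (0, 1), k, by rwa [← hlin], fun y s hy => ?_⟩
  rw [← hlin]
  exact hf (y, s) (by simpa [extendTop_coe] using hy)

/-- A proper convex lower semicontinuous function on `[0, ∞)` is the supremum of its affine
minorants. -/
theorem exists_affine_minorant (hL : EConvex (extendTop L)) (hlsc : LowerSemicontinuous L)
    (hbot : ∀ x, L x ≠ ⊥) {x₀ : ℝ≥0} (hx₀ : L x₀ ≠ ⊤) {x : ℝ≥0} {r : ℝ}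
    (h : (r : EReal) < L x) :
    ∃ u w : ℝ, r < u * x + w ∧ ∀ y : ℝ≥0, ((u * y + w : ℝ) : EReal) ≤ L y := by
  have hle₀ : L x₀ ≤ ((L x₀).toReal : EReal) := EReal.le_coe_toReal hx₀
  -- a separating functional is never decreasing in the vertical direction
  have hv0 : ∀ {u v k : ℝ}, (∀ (y : ℝ≥0) (s : ℝ), L y ≤ (s : EReal) → k < u * y + v * s) →
      0 ≤ v := by
    intro u v k hsep
    by_contra! hv
    obtain ⟨n, hn⟩ := exists_nat_gt ((u * x₀ + v * (L x₀).toReal - k) / (-v))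
    rw [div_lt_iff₀ (by linarith)] at hn
    have := hsep x₀ ((L x₀).toReal + n) (hle₀.trans (by
      rw [EReal.coe_le_coe_iff]; linarith [n.cast_nonneg (α := ℝ)]))
    nlinarith
  -- a separating functional that is not vertical gives an affine minorant
  have hminor : ∀ {u v k : ℝ}, 0 < v →
      (∀ (y : ℝ≥0) (s : ℝ), L y ≤ (s : EReal) → k < u * y + v * s) →
      ∀ y : ℝ≥0, ((-u / v * y + k / v : ℝ) : EReal) ≤ L y := by
    intro u v k hv hsep y
    by_cases hy : L y = ⊤
    · simp [hy]
    rw [← EReal.coe_toReal hy (hbot y), EReal.coe_le_coe_iff]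
    have := hsep y _ (EReal.le_coe_toReal hy)
    have e : -u / v * y + k / v = (k - u * y) / v := by ring
    rw [e, div_le_iff₀ hv]
    linarith
  obtain ⟨u, v, k, hlt, hsep⟩ := exists_separation hL hlsc (x := x) (by rwa [extendTop_coe])
  rcases (hv0 hsep).eq_or_lt with hv | hv
  -- Vertical separation: `k - u y` is negative on the domain of `L` and positive at `x`. A large
  -- multiple of it is added to a minorant obtained by separating at `x₀`, where finiteness of `L`
  -- excludes a vertical functional.
  · subst hv
    obtain ⟨u', v', k', hlt', hsep'⟩ := exists_separation hL hlsc (x := x₀)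
      (r := (L x₀).toReal - 1) (by
        rw [extendTop_coe, ← EReal.coe_toReal hx₀ (hbot x₀), EReal.coe_lt_coe_iff,
          EReal.toReal_coe]
        linarith)
    have hv' : 0 < v' := by
      have := hsep' x₀ _ hle₀
      nlinarith
    have hmin := hminor hv' hsep'
    set A := -u' / v' * x + k' / v' with hA
    obtain ⟨n, hn⟩ := exists_nat_gt ((r - A) / (k - u * x))
    have hpos : 0 < k - u * x := by linarith
    rw [div_lt_iff₀ hpos] at hn
    refine ⟨-u' / v' - n * u, k' / v' + n * k, by nlinarith, fun y => ?_⟩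
    by_cases hy : L y = ⊤
    · simp [hy]
    refine le_trans ?_ (hmin y)
    rw [EReal.coe_le_coe_iff]
    have h1 := hsep y _ (EReal.le_coe_toReal hy)
    have h2 : (n : ℝ) * k ≤ n * (u * y) :=
      mul_le_mul_of_nonneg_left (by linarith) n.cast_nonneg
    linarith
  · refine ⟨-u / v, k / v, ?_, hminor hv hsep⟩
    have e : -u / v * x + k / v = (k - u * x) / v := by ring
    rw [e, lt_div_iff₀ hv]
    linarith

end PhiIPM

/-! ### Conjugates of the optimal lower bounds. -/

namespace PhiIPM

/-- As `a` is finite, no indeterminate form arises even for infinite `b` and `c`. -/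
theorem coe_sub_le_comm (a : ℝ) (b c : EReal) : (a : EReal) - b ≤ c ↔ (a : EReal) - c ≤ b := by
  induction b with
  | bot =>
    induction c with
    | bot => simp
    | top => simp
    | coe c =>
      rw [EReal.coe_sub_bot, ← EReal.coe_sub]
      exact iff_of_false (by simp) fun h => EReal.coe_ne_bot _ (le_bot_iff.1 h)
  | top => simp
  | coe b =>
    induction c with
    | bot =>
      rw [EReal.coe_sub_bot, ← EReal.coe_sub]
      exact iff_of_false (fun h => EReal.coe_ne_bot _ (le_bot_iff.1 h)) (by simp)
    | top => simp
    | coe c =>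
      rw [← EReal.coe_sub, ← EReal.coe_sub, EReal.coe_le_coe_iff, EReal.coe_le_coe_iff]
      constructor <;> intro h <;> linarith

theorem conj_le_iff {f : ℝ → EReal} {t : ℝ} {S : EReal} :
    conj f t ≤ S ↔ ∀ x : ℝ, ((x * t : ℝ) : EReal) - S ≤ f x := by
  rw [conj, iSup_le_iff]
  exact forall_congr' fun x => coe_sub_le_comm _ _ _

variable {Ω : Type*} [MeasurableSpace Ω] {φ : ℝ → EReal} {X : Submodule ℝ (SignedMeasure Ω)}
  {Y : Submodule ℝ (Ω → ℝ)} {G : Set (Ω → ℝ)} {M N : Set (ProbabilityMeasure Ω)}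

theorem lowerBound_singleton (φ : ℝ → EReal) (M N : Set (ProbabilityMeasure Ω)) (g : Ω → ℝ)
    (ε : ℝ) : lowerBound φ M {g} N ε = sInf {d : EReal | ∃ ν ∈ N, ∃ μ ∈ M,
      meanDev g (μ : Measure Ω) (ν : Measure Ω) = ε ∧
      d = phiDiv φ (μ : Measure Ω) (ν : Measure Ω)} := by
  simp [lowerBound]

/-- The triple `(g, ν, μ)` determines `ε`, so the constraint disappears once the conjugate is taken.
-/
theorem conj_iInf_lowerBound_le_iff {t : ℝ} {S : EReal} :
    conj (fun ε => ⨅ g ∈ G, lowerBound φ M {g} N ε) t ≤ S ↔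
      ∀ g ∈ G, ∀ ν ∈ N, ∀ μ ∈ M,
        ((t * meanDev g (μ : Measure Ω) (ν : Measure Ω) : ℝ) : EReal) -
          phiDiv φ (μ : Measure Ω) (ν : Measure Ω) ≤ S := by
  simp only [conj_le_iff, le_iInf_iff, lowerBound_singleton, le_sInf_iff]
  constructor
  · intro h g hg ν hν μ hμ
    rw [coe_sub_le_comm, mul_comm]
    exact h _ g hg _ ⟨ν, hν, μ, hμ, rfl, rfl⟩
  · rintro h x g hg _ ⟨ν, hν, μ, hμ, rfl, rfl⟩
    rw [coe_sub_le_comm, mul_comm]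
    exact h g hg ν hν μ hμ

theorem meanDev_self (g : Ω → ℝ) (ν : Measure Ω) : meanDev g ν ν = 0 := sub_self _

theorem IsDivergenceGenerator.phiDiv_self (hφ : IsDivergenceGenerator φ) (ν : Measure Ω)
    [SigmaFinite ν] : phiDiv φ ν ν = 0 := by
  rw [hφ.phiDiv_eq, hφ.divENN_self, EReal.coe_ennreal_zero]

theorem IsDivergenceGenerator.phiDiv_nonneg (hφ : IsDivergenceGenerator φ) (μ ν : Measure Ω) :
    0 ≤ phiDiv φ μ ν := by
  rw [hφ.phiDiv_eq]
  exact EReal.coe_ennreal_nonneg _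

theorem IsDivergenceGenerator.exists_real_phiDiv (hφ : IsDivergenceGenerator φ) {μ ν : Measure Ω}
    (h : phiDiv φ μ ν ≠ ⊤) : ∃ d : ℝ, 0 ≤ d ∧ phiDiv φ μ ν = (d : EReal) := by
  have hbot : phiDiv φ μ ν ≠ ⊥ := fun hb => by simpa [hb] using hφ.phiDiv_nonneg μ ν
  exact ⟨_, EReal.toReal_nonneg (hφ.phiDiv_nonneg μ ν), (EReal.coe_toReal h hbot).symm⟩

theorem meanDev_const_mul (t : ℝ) (g : Ω → ℝ) (μ ν : Measure Ω) :
    meanDev (fun ω => t * g ω) μ ν = t * meanDev g μ ν := by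
  rw [meanDev, meanDev, integral_const_mul, integral_const_mul, mul_sub]

/-- The cumulant generating function is the conjugate of the optimal lower bound for one function
and one reference measure. -/
theorem IsDecomposable.cgf_le_iff {ν : ProbabilityMeasure Ω}
    (hdec : IsDecomposable X Y (ν : Measure Ω)) (hφ : IsDivergenceGenerator φ) {g : Ω → ℝ}
    (hg : g ∈ Y) {t : ℝ} {S : EReal} :
    cgf φ (nullIdeal X) g (ν : Measure Ω) t ≤ S ↔ ∀ μ ∈ probIn X,
      ((t * meanDev g (μ : Measure Ω) (ν : Measure Ω) : ℝ) : EReal) -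
        phiDiv φ (μ : Measure Ω) (ν : Measure Ω) ≤ S := by
  have htg : (fun ω => t * g ω) ∈ Y := Y.smul_mem t hg
  constructor
  · intro h μ hμ
    refine le_trans (le_sInf ?_) h
    rintro _ ⟨c, hc, rfl⟩
    have hw := hφ.ofReal_meanDev_le hdec.dualPair hμ hdec.mem htg hc
    rw [meanDev_const_mul] at hw
    refine EReal.sub_le_of_le_add' ?_
    rw [eintegral_of_nonneg _ fun ω => conj_shift_nonneg hφ.map_one _, hφ.phiDiv_eq,
      ← EReal.coe_ennreal_add]
    refine le_trans ?_ (EReal.coe_ennreal_le_coe_ennreal_iff.2 hw)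
    rw [EReal.coe_ennreal_ofReal]
    exact_mod_cast le_max_left _ _
  · intro h
    -- Test with `μ = ν`.
    have h0 : 0 ≤ S := by
      simpa [meanDev_self, hφ.phiDiv_self] using h ν hdec.mem
    by_cases htop : S = ⊤
    · simp [htop]
    have hbot : S ≠ ⊥ := fun hb => by simp [hb] at h0
    obtain ⟨c, hc, hle⟩ := hdec.exists_lintegral_conj_le hφ htg (S := S.toReal) (by
      intro μ hμ hD
      have := h μ hμ
      rw [hφ.phiDiv_eq, ← EReal.coe_toReal htop hbot, ← EReal.coe_ennreal_toReal hD,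
        ← EReal.coe_sub, EReal.coe_le_coe_iff] at this
      rw [meanDev_const_mul]
      linarith)
    rw [cgf]
    refine sInf_le_of_le ⟨c, hc, rfl⟩ ?_
    rw [eintegral_of_nonneg _ fun ω => conj_shift_nonneg hφ.map_one _]
    refine (EReal.coe_ennreal_le_coe_ennreal_iff.2 hle).trans (le_of_eq ?_)
    rw [EReal.coe_ennreal_ofReal, max_eq_left (EReal.toReal_nonneg h0), EReal.coe_toReal htop hbot]

theorem IsDualPair.ipm_eq (hXY : IsDualPair X Y) (hGY : ∀ g ∈ G, g ∈ Y) {μ ν : Measure Ω}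
    [IsFiniteMeasure μ] [IsFiniteMeasure ν] (hμ : μ.toSignedMeasure ∈ X)
    (hν : ν.toSignedMeasure ∈ X) :
    ipm G μ ν = ⨆ g ∈ G, ENNReal.ofReal |meanDev g μ ν| := by
  rw [ipm]
  refine iSup_congr fun g => iSup_congr fun hg => ?_
  rw [if_pos ⟨hXY.integrable_of_mem hμ (hGY g hg), hXY.integrable_of_mem hν (hGY g hg)⟩]

/-- For `t ≥ 0` each `t (μ(g) - ν(g))` is at most `t` times the supremum over `G`, a real number by
`hfin`; for `t ≤ 0` the infimum plays this role. If that extremum has the sign not covered by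
`lowerBound`, the product is at most 0 and the bound is trivial. -/
theorem IsDivergenceGenerator.conj_lowerBound_eq (hφ : IsDivergenceGenerator φ)
    (hXY : IsDualPair X Y) (hG : G.Nonempty) (hGY : ∀ g ∈ G, g ∈ Y) (hN : N ⊆ probIn X)
    (hfin : ∀ ν ∈ N, ∀ μ ∈ probIn X, phiDiv φ (μ : Measure Ω) (ν : Measure Ω) < ⊤ →
      ipm G (μ : Measure Ω) (ν : Measure Ω) < ⊤) :
    conj (lowerBound φ (probIn X) G N) =
      conj (fun ε => ⨅ g ∈ G, lowerBound φ (probIn X) {g} N ε) := by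
  funext t
  refine eq_of_forall_ge_iff fun S => ?_
  rw [conj_iInf_lowerBound_le_iff, conj_le_iff]
  constructor
  · intro h g hg ν hν μ hμ
    have hsup : ∀ μ ∈ probIn X, ∀ s : ℝ, 0 ≤ s →
        (⨆ g ∈ G, ((meanDev g (μ : Measure Ω) (ν : Measure Ω) : ℝ) : EReal)) = (s : EReal) →
        ((s * t : ℝ) : EReal) - phiDiv φ (μ : Measure Ω) (ν : Measure Ω) ≤ S := by
      intro μ hμ s hs hsup
      refine (coe_sub_le_comm _ _ _).1 ((h s).trans ?_)
      rw [lowerBound, if_pos hs]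
      exact sInf_le ⟨ν, hν, μ, hμ, hsup, rfl⟩
    have hinf : ∀ s : ℝ, s < 0 →
        (⨅ g ∈ G, ((meanDev g (μ : Measure Ω) (ν : Measure Ω) : ℝ) : EReal)) = (s : EReal) →
        ((s * t : ℝ) : EReal) - phiDiv φ (μ : Measure Ω) (ν : Measure Ω) ≤ S := by
      intro s hs hinf
      refine (coe_sub_le_comm _ _ _).1 ((h s).trans ?_)
      rw [lowerBound, if_neg hs.not_ge]
      exact sInf_le ⟨ν, hν, μ, hμ, hinf, rfl⟩
    have h0 : 0 ≤ S := by
      have := hsup ν (hN hν) 0 le_rfl (by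
        simp only [meanDev_self]
        exact biSup_const hG)
      simpa [hφ.phiDiv_self] using this
    have hneg : t * meanDev g (μ : Measure Ω) (ν : Measure Ω) ≤ 0 →
        ((t * meanDev g (μ : Measure Ω) (ν : Measure Ω) : ℝ) : EReal) -
          phiDiv φ (μ : Measure Ω) (ν : Measure Ω) ≤ S := fun hle => by
      refine (EReal.sub_nonpos.2 (le_trans ?_ (hφ.phiDiv_nonneg _ _))).trans h0
      exact_mod_cast hle
    by_cases hD : phiDiv φ (μ : Measure Ω) (ν : Measure Ω) = ⊤
    · simp [hD]
    have hipm := hfin ν hν μ hμ (lt_top_iff_ne_top.2 hD)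
    rw [hXY.ipm_eq hGY hμ (hN hν)] at hipm
    set B := (⨆ g ∈ G, ENNReal.ofReal |meanDev g (μ : Measure Ω) (ν : Measure Ω)|).toReal
    have hB : ∀ g ∈ G, |meanDev g (μ : Measure Ω) (ν : Measure Ω)| ≤ B := fun g hg =>
      (ENNReal.ofReal_le_iff_le_toReal hipm.ne).1
        (le_iSup₂ (f := fun g _ => ENNReal.ofReal |meanDev g (μ : Measure Ω) (ν : Measure Ω)|)
          g hg)
    rcases le_total 0 t with ht | ht
    · set s := ⨆ g ∈ G, ((meanDev g (μ : Measure Ω) (ν : Measure Ω) : ℝ) : EReal) with hs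
      have hge : ((meanDev g (μ : Measure Ω) (ν : Measure Ω) : ℝ) : EReal) ≤ s :=
        le_iSup₂ (f := fun g _ => ((meanDev g (μ : Measure Ω) (ν : Measure Ω) : ℝ) : EReal)) g hg
      have hle : s ≤ (B : EReal) := iSup₂_le fun g hg =>
        EReal.coe_le_coe_iff.2 ((le_abs_self _).trans (hB g hg))
      have hst : s ≠ ⊤ := ne_top_of_le_ne_top (EReal.coe_ne_top B) hle
      have hsb : s ≠ ⊥ := ne_bot_of_le_ne_bot (EReal.coe_ne_bot _) hge
      rw [← EReal.coe_toReal hst hsb, EReal.coe_le_coe_iff] at hge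
      rcases le_or_gt 0 s.toReal with h1 | h1
      · refine le_trans (EReal.sub_le_sub ?_ le_rfl)
          (hsup μ hμ s.toReal h1 (EReal.coe_toReal hst hsb).symm)
        rw [EReal.coe_le_coe_iff, mul_comm]
        exact mul_le_mul_of_nonneg_right hge ht
      · exact hneg (mul_nonpos_of_nonneg_of_nonpos ht (hge.trans h1.le))
    · set s := ⨅ g ∈ G, ((meanDev g (μ : Measure Ω) (ν : Measure Ω) : ℝ) : EReal) with hs
      have hle : s ≤ ((meanDev g (μ : Measure Ω) (ν : Measure Ω) : ℝ) : EReal) :=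
        iInf₂_le (f := fun g _ => ((meanDev g (μ : Measure Ω) (ν : Measure Ω) : ℝ) : EReal)) g hg
      have hge : ((-B : ℝ) : EReal) ≤ s := le_iInf₂ fun g hg =>
        EReal.coe_le_coe_iff.2 (neg_le_of_abs_le (hB g hg))
      have hst : s ≠ ⊤ := ne_top_of_le_ne_top (EReal.coe_ne_top _) hle
      have hsb : s ≠ ⊥ := ne_bot_of_le_ne_bot (EReal.coe_ne_bot _) hge
      rw [← EReal.coe_toReal hst hsb, EReal.coe_le_coe_iff] at hle
      rcases lt_or_ge s.toReal 0 with h1 | h1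
      · refine le_trans (EReal.sub_le_sub ?_ le_rfl)
          (hinf s.toReal h1 (EReal.coe_toReal hst hsb).symm)
        rw [EReal.coe_le_coe_iff, mul_comm]
        exact mul_le_mul_of_nonpos_right hle ht
      · exact hneg (mul_nonpos_of_nonpos_of_nonneg ht (h1.trans hle))
  · intro h ε
    rw [lowerBound]
    have hnonneg : ∀ ν ∈ N, 0 ≤ S := fun ν hν => by
      obtain ⟨g, hg⟩ := hG
      simpa [meanDev_self, hφ.phiDiv_self] using h g hg ν hν ν (hN hν)
    have hneg : ∀ ν ∈ N, ∀ μ ∈ probIn X, ε * t ≤ 0 →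
        ((ε * t : ℝ) : EReal) - phiDiv φ (μ : Measure Ω) (ν : Measure Ω) ≤ S := by
      intro ν hν μ hμ hle
      refine (EReal.sub_nonpos.2 (le_trans ?_ (hφ.phiDiv_nonneg _ _))).trans (hnonneg ν hν)
      exact_mod_cast hle
    split_ifs with hε
    · refine le_sInf ?_
      rintro _ ⟨ν, hν, μ, hμ, hsup, rfl⟩
      rw [coe_sub_le_comm]
      rcases le_total t 0 with ht | ht
      · exact hneg ν hν μ hμ (mul_nonpos_of_nonneg_of_nonpos hε ht)
      by_cases hD : phiDiv φ (μ : Measure Ω) (ν : Measure Ω) = ⊤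
      · simp [hD]
      obtain ⟨d, -, hd⟩ := hφ.exists_real_phiDiv hD
      by_cases hSt : S = ⊤
      · simp [hSt]
      have hSb : S ≠ ⊥ := fun hb => by simpa [hb] using hnonneg ν hν
      rcases ht.eq_or_lt with rfl | ht
      · exact hneg ν hν μ hμ (by simp)
      -- Dividing by `t > 0` gives a bound on each deviation that is uniform in `g`, hence a bound
      -- on their supremum `ε`.
      have hle : (ε : EReal) ≤ (((S.toReal + d) / t : ℝ) : EReal) := by
        rw [← hsup]
        refine iSup₂_le fun g hg => ?_
        have := h g hg ν hν μ hμ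
        rw [hd, ← EReal.coe_toReal hSt hSb, ← EReal.coe_sub, EReal.coe_le_coe_iff] at this
        rw [EReal.coe_le_coe_iff, le_div_iff₀ ht]
        linarith
      rw [EReal.coe_le_coe_iff, le_div_iff₀ ht] at hle
      rw [hd, ← EReal.coe_toReal hSt hSb, ← EReal.coe_sub, EReal.coe_le_coe_iff]
      linarith
    · refine le_sInf ?_
      rintro _ ⟨ν, hν, μ, hμ, hinf, rfl⟩
      rw [coe_sub_le_comm]
      push Not at hε
      rcases le_total 0 t with ht | ht
      · exact hneg ν hν μ hμ (mul_nonpos_of_nonpos_of_nonneg hε.le ht)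
      by_cases hD : phiDiv φ (μ : Measure Ω) (ν : Measure Ω) = ⊤
      · simp [hD]
      obtain ⟨d, -, hd⟩ := hφ.exists_real_phiDiv hD
      by_cases hSt : S = ⊤
      · simp [hSt]
      have hSb : S ≠ ⊥ := fun hb => by simpa [hb] using hnonneg ν hν
      rcases ht.eq_or_lt with rfl | ht
      · exact hneg ν hν μ hμ (by simp)
      have hle : (((S.toReal + d) / t : ℝ) : EReal) ≤ (ε : EReal) := by
        rw [← hinf]
        refine le_iInf₂ fun g hg => ?_
        have := h g hg ν hν μ hμ
        rw [hd, ← EReal.coe_toReal hSt hSb, ← EReal.coe_sub, EReal.coe_le_coe_iff] at this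
        rw [EReal.coe_le_coe_iff, div_le_iff_of_neg ht]
        linarith
      rw [EReal.coe_le_coe_iff, div_le_iff_of_neg ht] at hle
      rw [hd, ← EReal.coe_toReal hSt hSb, ← EReal.coe_sub, EReal.coe_le_coe_iff]
      linarith

end PhiIPM

/-! ### The operational form. -/

namespace PhiIPM

variable {Ω : Type*} [MeasurableSpace Ω] {φ : ℝ → EReal} {X : Submodule ℝ (SignedMeasure Ω)}
  {Y : Submodule ℝ (Ω → ℝ)} {G : Set (Ω → ℝ)} {N : Set (ProbabilityMeasure Ω)} {L : ℝ≥0 → EReal}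

/-- The sublevel set `{L ≤ D}` is closed and contains all deviations, hence their supremum. If that
is infinite, `L ≤ D` holds at arbitrarily large points. -/
theorem LowerBoundsByDeviation.lowerBoundsByIPM (hφ : IsDivergenceGenerator φ)
    (hXY : IsDualPair X Y) (hG : G.Nonempty) (hGY : ∀ g ∈ G, g ∈ Y) (hN : N ⊆ probIn X)
    (hL : EConvex (extendTop L)) (hlsc : LowerSemicontinuous L)
    (h : LowerBoundsByDeviation φ (probIn X) G N L) : LowerBoundsByIPM φ (probIn X) G N L := by
  intro ν hν μ hμ
  by_cases hD : phiDiv φ (μ : Measure Ω) (ν : Measure Ω) = ⊤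
  · simp [hD]
  obtain ⟨d, -, hd⟩ := hφ.exists_real_phiDiv hD
  have hg : ∀ g ∈ G, L (Real.toNNReal |meanDev g (μ : Measure Ω) (ν : Measure Ω)|) ≤ (d : EReal) :=
    fun g hg => hd ▸ h g hg ν hν μ hμ
  have hle : ∀ b : ℝ≥0, ipm G (μ : Measure Ω) (ν : Measure Ω) ≤ b ↔
      ∀ g ∈ G, Real.toNNReal |meanDev g (μ : Measure Ω) (ν : Measure Ω)| ≤ b := fun b => by
    rw [hXY.ipm_eq hGY hμ (hN hν), iSup₂_le_iff]
    exact forall₂_congr fun g _ => ENNReal.coe_le_coe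
  rw [hd, evalExt]
  split_ifs with htop
  · refine limsup_le_of_frequently hL (frequently_atTop.2 fun b => ?_)
    have hnot : ¬ ipm G (μ : Measure Ω) (ν : Measure Ω) ≤ b := by simp [htop]
    rw [hle] at hnot
    push Not at hnot
    obtain ⟨g, hgG, hgb⟩ := hnot
    exact ⟨_, hgb.le, hg g hgG⟩
  · have hclosed : IsClosed {y : ℝ≥0 | L y ≤ (d : EReal)} := hlsc.isClosed_preimage _
    have hlub : IsLUB ((fun g => Real.toNNReal |meanDev g (μ : Measure Ω) (ν : Measure Ω)|) '' G)
        (ipm G (μ : Measure Ω) (ν : Measure Ω)).toNNReal := by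
      constructor
      · rintro _ ⟨g, hgG, rfl⟩
        exact (hle _).1 (ENNReal.coe_toNNReal htop).ge g hgG
      · intro b hb
        rw [← ENNReal.coe_le_coe, ENNReal.coe_toNNReal htop, hle]
        exact fun g hgG => hb ⟨g, hgG, rfl⟩
    refine closure_minimal ?_ hclosed (hlub.mem_closure (hG.image _))
    rintro _ ⟨g, hgG, rfl⟩
    exact hg g hgG

theorem LowerBoundsByIPM.apply_zero_le (hφ : IsDivergenceGenerator φ) (hXY : IsDualPair X Y)
    (hGY : ∀ g ∈ G, g ∈ Y) (hN : N ⊆ probIn X) (h : LowerBoundsByIPM φ (probIn X) G N L)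
    {ν : ProbabilityMeasure Ω} (hν : ν ∈ N) : L 0 ≤ 0 := by
  have h1 := h ν hν ν (hN hν)
  have h2 : ipm G (ν : Measure Ω) (ν : Measure Ω) = 0 := by
    rw [hXY.ipm_eq hGY (hN hν) (hN hν)]
    simp [meanDev_self]
  rw [hφ.phiDiv_self, h2] at h1
  simpa [evalExt] using h1

/-- Along the segment from `ν` to `μ` the deviations scale linearly and the divergence at most
linearly. -/
theorem IsDualPair.exists_mixture (hXY : IsDualPair X Y) (hφ : IsDivergenceGenerator φ)
    (hGY : ∀ g ∈ G, g ∈ Y) {μ ν : ProbabilityMeasure Ω} (hμ : μ ∈ probIn X) (hν : ν ∈ probIn X)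
    {d : ℝ} (hd : phiDiv φ (μ : Measure Ω) (ν : Measure Ω) = (d : EReal)) {a : ℝ≥0} (ha : 0 < a)
    (ha1 : a ≤ 1) : ∃ κ ∈ probIn X,
      ipm G (κ : Measure Ω) (ν : Measure Ω) = a * ipm G (μ : Measure Ω) (ν : Measure Ω) ∧
      phiDiv φ (κ : Measure Ω) (ν : Measure Ω) ≤ ((a * d : ℝ) : EReal) := by
  obtain ⟨b, hab⟩ : ∃ b : ℝ≥0, b + a = 1 := ⟨1 - a, tsub_add_cancel_of_le ha1⟩
  have hprob : IsProbabilityMeasure (b • (ν : Measure Ω) + a • (μ : Measure Ω)) := by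
    refine ⟨?_⟩
    rw [Measure.add_apply, Measure.smul_apply, Measure.smul_apply, measure_univ, measure_univ,
      ENNReal.smul_def, ENNReal.smul_def, smul_eq_mul, smul_eq_mul, mul_one, mul_one]
    exact_mod_cast hab
  have hX : (b • (ν : Measure Ω) + a • (μ : Measure Ω)).toSignedMeasure ∈ X := by
    rw [Measure.toSignedMeasure_add, Measure.toSignedMeasure_smul, Measure.toSignedMeasure_smul]
    exact X.add_mem (X.smul_mem (b : ℝ) hν) (X.smul_mem (a : ℝ) hμ)
  refine ⟨⟨_, hprob⟩, hX, ?_, ?_⟩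
  · change ipm G (b • (ν : Measure Ω) + a • (μ : Measure Ω)) (ν : Measure Ω) = _
    rw [hXY.ipm_eq hGY hX hν, hXY.ipm_eq hGY hμ hν]
    simp only [ENNReal.mul_iSup]
    refine iSup_congr fun g => iSup_congr fun hg => ?_
    have hgμ := hXY.integrable_of_mem hμ (hGY g hg)
    have hgν := hXY.integrable_of_mem hν (hGY g hg)
    have hb : (b : ℝ) = 1 - a := by rw [eq_sub_iff_add_eq]; exact_mod_cast hab
    have : meanDev g (b • (ν : Measure Ω) + a • (μ : Measure Ω)) (ν : Measure Ω) =
        a * meanDev g (μ : Measure Ω) (ν : Measure Ω) := by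
      rw [meanDev, meanDev, integral_add_measure hgν.smul_measure_nnreal
        hgμ.smul_measure_nnreal, integral_smul_nnreal_measure, integral_smul_nnreal_measure]
      simp only [NNReal.smul_def, smul_eq_mul, hb]
      ring
    rw [this, abs_mul, ENNReal.ofReal_mul (abs_nonneg _)]
    simp
  · change phiDiv φ (b • (ν : Measure Ω) + a • (μ : Measure Ω)) (ν : Measure Ω) ≤ _
    have h := EReal.coe_ennreal_le_coe_ennreal_iff.2
      (hφ.divENN_mix_le (μ : Measure Ω) (ν : Measure Ω) ha hab)
    rw [EReal.coe_ennreal_mul, ← hφ.phiDiv_eq, ← hφ.phiDiv_eq, hd] at h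
    exact h

/-- Taking `μ = ν` gives `L 0 ≤ 0`, so the interval `{L ≤ D}` contains 0 and `d_G`, and with them
each deviation. -/
theorem LowerBoundsByIPM.lowerBoundsByDeviation (hφ : IsDivergenceGenerator φ)
    (hXY : IsDualPair X Y) (hGY : ∀ g ∈ G, g ∈ Y) (hN : N ⊆ probIn X)
    (hL : EConvex (extendTop L)) (h : LowerBoundsByIPM φ (probIn X) G N L) :
    LowerBoundsByDeviation φ (probIn X) G N L := by
  intro g hg ν hν μ hμ
  have h0 : L 0 ≤ 0 := h.apply_zero_le hφ hXY hGY hN hν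
  by_cases hD : phiDiv φ (μ : Measure Ω) (ν : Measure Ω) = ⊤
  · simp [hD]
  obtain ⟨d, hd0, hd⟩ := hφ.exists_real_phiDiv hD
  have hd0' : (0 : EReal) ≤ (d : EReal) := by exact_mod_cast hd0
  rw [hd]
  by_cases htop : ipm G (μ : Measure Ω) (ν : Measure Ω) = ⊤
  -- Moving `μ` towards `ν` keeps `d_G` infinite while the divergence tends to 0, so `L(∞) ≤ 0`.
  · refine (apply_nonpos_of_limsup hL h0 ?_ _).trans hd0'
    have hlim : Tendsto (fun n : ℕ => (((1 / ((n : ℝ) + 1)) * d : ℝ) : EReal)) atTop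
        (𝓝 ((0 : ℝ) : EReal)) := by
      refine (continuous_coe_real_ereal.tendsto _).comp ?_
      simpa using tendsto_one_div_add_atTop_nhds_zero_nat.mul_const d
    refine ge_of_tendsto' hlim fun n => ?_
    obtain ⟨κ, hκ, hκi, hκd⟩ := hXY.exists_mixture hφ hGY hμ (hN hν) hd
      (a := 1 / ((n : ℝ≥0) + 1)) (by positivity)
      (by rw [div_le_one (by positivity)]; exact le_add_of_nonneg_left zero_le)
    have h1 := (h ν hν κ hκ).trans hκd
    rw [hκi, htop, ENNReal.mul_top (by simp), evalExt, if_pos rfl] at h1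
    simpa using h1
  · have h1 := h ν hν μ hμ
    rw [hd, evalExt, if_neg htop] at h1
    refine le_of_mem_Icc hL (h0.trans hd0') h1 zero_le ?_
    rw [← ENNReal.coe_le_coe, ENNReal.coe_toNNReal htop, hXY.ipm_eq hGY hμ (hN hν)]
    exact le_iSup₂ (f := fun g _ => ENNReal.ofReal |meanDev g (μ : Measure Ω) (ν : Measure Ω)|)
      g hg

theorem LowerBoundsByDeviation.cgfBoundedByConj (hφ : IsDivergenceGenerator φ)
    (hGY : ∀ g ∈ G, g ∈ Y) (hdec : ∀ ν ∈ N, IsDecomposable X Y (ν : Measure Ω))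
    (h : LowerBoundsByDeviation φ (probIn X) G N L) :
    CgfBoundedByConj φ (nullIdeal X) G N L := by
  intro t g hg ν hν
  rw [(hdec ν hν).cgf_le_iff hφ (hGY g hg)]
  intro μ hμ
  refine le_iSup_of_le |meanDev g (μ : Measure Ω) (ν : Measure Ω)| (EReal.sub_le_sub ?_ ?_)
  · rw [EReal.coe_le_coe_iff, mul_comm, ← abs_mul]
    exact le_abs_self _
  · rw [extendTop, if_pos (abs_nonneg _)]
    exact h g hg ν hν μ hμ

/-- A minorant `u x + w` of `L` with `u ≥ 0` gives `L*(u) ≤ -w`, and the hypothesis at `t = ±u` then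
yields `u |μ(g) - ν(g)| + w ≤ D`. Negative slopes are not reached by `|t|`: there the minorant is at
most `w ≤ L 0`, so `L 0 ≤ 0` suffices, and monotonicity makes the constant `w` a minorant of slope
0. -/
theorem CgfBoundedByConj.lowerBoundsByDeviation (hφ : IsDivergenceGenerator φ)
    (hGY : ∀ g ∈ G, g ∈ Y) (hdec : ∀ ν ∈ N, IsDecomposable X Y (ν : Measure Ω))
    (hL : EConvex (extendTop L)) (hlsc : LowerSemicontinuous L) (hbot : ∀ x, L x ≠ ⊥)
    (hmon : L 0 ≤ 0 ∨ Monotone L) (h : CgfBoundedByConj φ (nullIdeal X) G N L) :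
    LowerBoundsByDeviation φ (probIn X) G N L := by
  intro g hg ν hν μ hμ
  have hcgf : ∀ t : ℝ, ∀ μ ∈ probIn X,
      ((t * meanDev g (μ : Measure Ω) (ν : Measure Ω) : ℝ) : EReal) -
        phiDiv φ (μ : Measure Ω) (ν : Measure Ω) ≤ conj (extendTop L) |t| := fun t =>
    ((hdec ν hν).cgf_le_iff hφ (hGY g hg)).1 (h t g hg ν hν)
  -- If `L` were identically `⊤`, its conjugate would be `⊥`, contradicting the bound at `t = 0`, `μ
  -- = ν`.
  obtain ⟨x₀, hx₀⟩ : ∃ x₀, L x₀ ≠ ⊤ := by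
    by_contra! htop
    have h1 := hcgf 0 ν (hdec ν hν).mem
    have h2 : conj (extendTop L) |0| = ⊥ := by
      simp [conj, extendTop, htop]
    rw [h2, hφ.phiDiv_self] at h1
    simp at h1
  by_cases hD : phiDiv φ (μ : Measure Ω) (ν : Measure Ω) = ⊤
  · simp [hD]
  obtain ⟨d, hd0, hd⟩ := hφ.exists_real_phiDiv hD
  rw [hd]
  by_contra! hlt
  obtain ⟨u, w, huw, hmin⟩ := exists_affine_minorant hL hlsc hbot hx₀ hlt
  rw [Real.coe_toNNReal _ (abs_nonneg _)] at huw
  have key : ∀ u : ℝ, 0 ≤ u → (∀ y : ℝ≥0, ((u * y + w : ℝ) : EReal) ≤ L y) →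
      u * |meanDev g (μ : Measure Ω) (ν : Measure Ω)| + w ≤ d := by
    intro u hu hmin
    obtain ⟨t, ht, htu⟩ : ∃ t : ℝ, |t| = u ∧ t * meanDev g (μ : Measure Ω) (ν : Measure Ω) =
        u * |meanDev g (μ : Measure Ω) (ν : Measure Ω)| := by
      rcases abs_cases (meanDev g (μ : Measure Ω) (ν : Measure Ω)) with ⟨e, -⟩ | ⟨e, -⟩
      · exact ⟨u, abs_of_nonneg hu, by rw [e]⟩
      · exact ⟨-u, by rw [abs_neg, abs_of_nonneg hu], by rw [e]; ring⟩
    have h1 := hcgf t μ hμ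
    rw [ht, htu, hd, ← EReal.coe_sub] at h1
    have h2 : conj (extendTop L) u ≤ ((-w : ℝ) : EReal) := by
      rw [conj_le_iff]
      intro y
      rw [extendTop]
      split_ifs with hy
      · refine le_trans (le_of_eq ?_) (hmin y.toNNReal)
        rw [← EReal.coe_sub, Real.coe_toNNReal y hy]
        congr 1
        ring
      · exact le_top
    have h3 := EReal.coe_le_coe_iff.1 (h1.trans h2)
    linarith
  rcases le_or_gt 0 u with hu | hu
  · linarith [key u hu hmin]
  have hneg : u * |meanDev g (μ : Measure Ω) (ν : Measure Ω)| ≤ 0 :=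
    mul_nonpos_of_nonpos_of_nonneg hu.le (abs_nonneg _)
  have hw : ((w : ℝ) : EReal) ≤ L 0 := by simpa using hmin 0
  rcases hmon with h0 | hmono
  · have : w ≤ 0 := by exact_mod_cast hw.trans h0
    linarith
  · have := key 0 le_rfl fun y => by
      simpa using hw.trans (hmono zero_le)
    linarith

end PhiIPM

/-! ### The theorem and its corollary. -/

theorem mainTheorem7 {Ω : Type*} [MeasurableSpace Ω]
    (φ : ℝ → EReal) (hφ : IsDivergenceGenerator φ)
    (X : Submodule ℝ (SignedMeasure Ω)) (Y : Submodule ℝ (Ω → ℝ)) (hXY : IsDualPair X Y)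
    (G : Set (Ω → ℝ)) (hG : G.Nonempty) (hGY : ∀ g ∈ G, g ∈ Y)
    (N : Set (ProbabilityMeasure Ω)) (hN : N ⊆ probIn X)
    (hdec : ∀ ν ∈ N, IsDecomposable X Y (ν : Measure Ω)) :
    -- the conjugates of the two optimal lower bound functions
    ((∀ ν ∈ N, ∀ μ ∈ probIn X, phiDiv φ (μ : Measure Ω) (ν : Measure Ω) < ⊤ →
        ipm G (μ : Measure Ω) (ν : Measure Ω) < ⊤) →
      conj (lowerBound φ (probIn X) G N) =
        conj (fun ε => ⨅ g ∈ G, lowerBound φ (probIn X) {g} N ε)) ∧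
    conj (fun ε => ⨅ g ∈ G, lowerBound φ (probIn X) {g} N ε) =
      cgfSet φ (nullIdeal X) G N ∧
    -- the operational form
    (∀ L : ℝ≥0 → EReal, EConvex (extendTop L) → LowerSemicontinuous L →
      (LowerBoundsByIPM φ (probIn X) G N L ↔ LowerBoundsByDeviation φ (probIn X) G N L) ∧
      (LowerBoundsByDeviation φ (probIn X) G N L → CgfBoundedByConj φ (nullIdeal X) G N L) ∧
      ((∀ x, L x ≠ ⊥) ∨ (∀ x, L x = ⊥) → L 0 ≤ 0 ∨ Monotone L →
        CgfBoundedByConj φ (nullIdeal X) G N L → LowerBoundsByIPM φ (probIn X) G N L)) := by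
  refine ⟨fun hfin => hφ.conj_lowerBound_eq hXY hG hGY hN hfin, ?_, fun L hL hlsc => ?_⟩
  · funext t
    refine eq_of_forall_ge_iff fun S => ?_
    rw [conj_iInf_lowerBound_le_iff, cgfSet]
    simp only [iSup_le_iff]
    exact forall₂_congr fun g hg => forall₂_congr fun ν hν =>
      ((hdec ν hν).cgf_le_iff hφ (hGY g hg)).symm
  · have h21 : LowerBoundsByDeviation φ (probIn X) G N L → LowerBoundsByIPM φ (probIn X) G N L :=
      fun h => h.lowerBoundsByIPM hφ hXY hG hGY hN hL hlsc
    refine ⟨⟨fun h => h.lowerBoundsByDeviation hφ hXY hGY hN hL, h21⟩,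
      fun h => h.cgfBoundedByConj hφ hGY hdec, ?_⟩
    rintro (hbot | hbot) hmon h
    · exact h21 (h.lowerBoundsByDeviation hφ hGY hdec hL hlsc hbot hmon)
    · refine h21 fun g _ ν _ μ _ => ?_
      rw [hbot]
      exact bot_le
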